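/- Let $\mathbb F=\mathbb R$ or $\mathbb C$. For $0<p\le 1$, a $p$-Banach space is a vector space $\mathbb X$ over $\mathbb F$ that is complete with respect to a map $\|\cdot\|:\mathbb X\to[0,\infty)$ which vanishes only at $0$, satisfies $\|cf\|=|c|\,\|f\|$, and is $p$-subadditive: $\|f+g\|^p\le\|f\|^p+\|g\|^p$. A fundamental minimal system of $\mathbb X$ is a sequence $\mathcal X=(\boldsymbol x_n)_{n\ge1}$ with dense linear span for which there are continuous linear functionals $(\boldsymbol x_n^*)_{n\ge1}$ with $\boldsymbol x_i^*(\boldsymbol x_j)=\delta_{ij}$; we always assume that $\sup_n\|\boldsymbol x_n\|<\infty$ and $\sup_n\|\boldsymbol x_n^*\|<\infty$. It is a Markushevich basis if the span of $(\boldsymbol x_n^*)$ is weak-star dense in $\mathbb X^*$, and a Schauder basis if, in addition, the projections $P_mf=\sum_{n\le m}\boldsymbol x_n^*(f)\boldsymbol x_n$ are uniformly bounded. Put $\operatorname{supp}(f)=\{n:\boldsymbol x_n^*(f)\ne0\}$. A finite set $B\subset\mathbb N$ is a greedy set of $f$ if $|\boldsymbol x_n^*(f)|\ge|\boldsymbol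 x_k^*(f)|$ for all $n\in B$, $k\notin B$. For a finite set $A$, let $\mathcal E_A$ be the set of families $\varepsilon=(\varepsilon_n)_{n\in A}$ in $\mathbb F$ with $|\varepsilon_n|=1$, and let $\mathbb 1_{\varepsilon,A}=\sum_{n\in A}\varepsilon_n\boldsymbol x_n$. For $m\ge1$: - $\boldsymbol\lambda_m$ is the smallest $C$ such that $\min_{n\in B}|\boldsymbol x_n^*(f)|\,\|\mathbb 1_{\varepsilon,A}\|\le C\|f\|$ whenever $f\in\mathbb X$, $B$ is a greedy set of $f$, $1\le|A|=|B|\le m$, and $\varepsilon\in\mathcal E_A$; - $\boldsymbol\lambda_m^d$ is the smallest such $C$ when, in addition, $A\cap\operatorname{supp}(f)=\emptyset$ is required; - $\boldsymbol\nu_m$ is the supremum of $\|\mathbb 1_{\varepsilon,A}+f\|/\|\mathbb 1_{\delta,B}+f\|$ over all finite sets with $|A|=|B|\le m$, all $\varepsilon\in\mathcal E_A$, $\delta\in\mathcal E_B$, and all $f\in\mathbb X$ with $\max_n|\boldsymbol x_n^*(f)|\le1$ and $\operatorname{supp}(f)\cap(A\cup B)=\emptyset$ (quotients $0/0$ being disregarded).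 For two such parameters $\mathbf a_m,\mathbf b_m$, let $\mathfrak R_B(\mathbf a_m,\mathbf b_m)\in[-\infty,\infty]$ be the infimum of all real $R$ such that for every $p\in(0,1]$, every $p$-Banach space $\mathbb X$ and every fundamental minimal system $\mathcal X$ of $\mathbb X$ there is a finite constant $C(\mathcal X,\mathbb X)$ with $\sup_{m\ge1}\mathbf a_m/(\mathbf b_m)^R\le C(\mathcal X,\mathbb X)$. Define $\mathfrak R_M$ and $\mathfrak R_S$ in the same way, with $\mathcal X$ ranging only over Markushevich bases and only over Schauder bases, respectively. **Proposition.** We have $$\mathfrak R_B(\boldsymbol\nu_m,\boldsymbol\lambda_m)=\mathfrak R_M(\boldsymbol\nu_m,\boldsymbol\lambda_m)=\mathfrak R_S(\boldsymbol\nu_m,\boldsymbol\lambda_m)=1,$$ and moreover $$\mathfrak R_B(\boldsymbol\nu_m,\boldsymbol\lambda_m^d)=\mathfrak R_M(\boldsymbol\nu_m,\boldsymbol\lambda_m^d)=2,\qquad \mathfrak R_S(\boldsymbol\nu_m,\boldsymbol\lambda_m^d)=1.$$ -/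

import Mathlib

open scoped ENNReal NNReal Uniformity

/-- `X`, with quasi-norm `‖·‖`, is a `p`-Banach space over `𝕜` (`0 < p ≤ 1`): the quasi-norm is
positive definite, absolutely homogeneous and `p`-subadditive, the uniform structure of `X` is the
one given by the quasi-norm, and `X` is complete. -/
class IsPBanachSpace (𝕜 : Type*) [RCLike 𝕜] (p : ℝ) (X : Type*) [AddCommGroup X] [Module 𝕜 X]
    [UniformSpace X] [Norm X] : Prop where
  p_pos : 0 < p
  p_le_one : p ≤ 1
  norm_nonneg : ∀ f : X, 0 ≤ ‖f‖
  norm_eq_zero_iff : ∀ f : X, ‖f‖ = 0 ↔ f = 0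
  norm_smul : ∀ (c : 𝕜) (f : X), ‖c • f‖ = ‖c‖ * ‖f‖
  norm_add_rpow_le : ∀ f g : X, ‖f + g‖ ^ p ≤ ‖f‖ ^ p + ‖g‖ ^ p
  uniformity_hasBasis :
    (𝓤 X).HasBasis (fun r : ℝ => 0 < r) (fun r => {q : X × X | ‖q.1 - q.2‖ < r})
  complete : CompleteSpace X

/-- A fundamental minimal system `(xₙ)` of `X` with its dual system `(xₙ*)`, both bounded.
(The dual system is determined by `(xₙ)`, since the span of `(xₙ)` is dense.) The index set is
`ℕ = {0, 1, 2, …}` in its natural order. -/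
structure FundamentalMinimalSystem (𝕜 : Type*) [RCLike 𝕜] (X : Type*) [AddCommGroup X]
    [Module 𝕜 X] [UniformSpace X] [Norm X] where
  /-- the vectors `xₙ` -/
  vec : ℕ → X
  /-- the coordinate functionals `xₙ*` -/
  dual : ℕ → (X →L[𝕜] 𝕜)
  biorthogonal : ∀ i j : ℕ, dual i (vec j) = if i = j then 1 else 0
  dense_span : Dense (Submodule.span 𝕜 (Set.range vec) : Set X)
  vec_bounded : ∃ C : ℝ, ∀ n, ‖vec n‖ ≤ C
  dual_bounded : ∃ C : ℝ, ∀ n f, ‖dual n f‖ ≤ C * ‖f‖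

namespace FundamentalMinimalSystem

variable {𝕜 : Type*} [RCLike 𝕜] {X : Type*} [AddCommGroup X] [Module 𝕜 X] [UniformSpace X]
  [Norm X]

/-- Markushevich basis: the span of the dual system is weak-star dense in the dual space. -/
def IsMarkushevich (S : FundamentalMinimalSystem 𝕜 X) : Prop :=
  Dense (Submodule.span 𝕜 (Set.range fun n => StrongDual.toWeakDual (S.dual n)) :
    Set (WeakDual 𝕜 X))

/-- The coordinate projection `P_A f = ∑_{n ∈ A} xₙ*(f) xₙ`. -/
def proj (S : FundamentalMinimalSystem 𝕜 X) (A : Finset ℕ) (f : X) : X :=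
  ∑ n ∈ A, S.dual n f • S.vec n

/-- Schauder basis: a Markushevich basis whose partial sum projections are uniformly bounded. -/
def IsSchauder (S : FundamentalMinimalSystem 𝕜 X) : Prop :=
  S.IsMarkushevich ∧ ∃ K : ℝ, ∀ (m : ℕ) (f : X), ‖S.proj (Finset.range m) f‖ ≤ K * ‖f‖

/-- The support of `f`: the set of all `n` with `xₙ*(f) ≠ 0`. -/
def supp (S : FundamentalMinimalSystem 𝕜 X) (f : X) : Set ℕ := {n | S.dual n f ≠ 0}

/-- `1_{ε,A} = ∑_{n ∈ A} εₙ xₙ`. -/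
def signedSum (S : FundamentalMinimalSystem 𝕜 X) (ε : ℕ → 𝕜) (A : Finset ℕ) : X :=
  ∑ n ∈ A, ε n • S.vec n

/-- `A` is a greedy set of `f` (of order `A.card`). -/
def IsGreedySet (S : FundamentalMinimalSystem 𝕜 X) (f : X) (A : Finset ℕ) : Prop :=
  ∀ n ∈ A, ∀ k ∉ A, ‖S.dual k f‖ ≤ ‖S.dual n f‖

end FundamentalMinimalSystem

/-- The family `ε` is a choice of signs on `A`: `|εₙ| = 1` for `n ∈ A` (its values outside `A` play
no role). -/
def IsSignOn {𝕜 : Type*} [RCLike 𝕜] (ε : ℕ → 𝕜) (A : Finset ℕ) : Prop := ∀ n ∈ A, ‖ε n‖ = 1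

universe u

/-- A parameter `(a_m)` attached to every fundamental minimal system. -/
abbrev SystemParameter (𝕜 : Type) [RCLike 𝕜] : Type (u + 1) :=
  ∀ (X : Type u) [AddCommGroup X] [Module 𝕜 X] [UniformSpace X] [Norm X],
    FundamentalMinimalSystem 𝕜 X → ℕ → ℝ≥0∞

/-- The squeeze symmetry parameter `λ_m`: the smallest `C` with
`min_{n ∈ B} |xₙ*(f)| ‖1_{ε,A}‖ ≤ C ‖f‖` whenever `B` is a greedy set of `f`, `|A| = |B| ≤ m` and
`ε` is a choice of signs on `A`. (For `A = B = ∅` the condition is void, as `1_{ε,∅} = 0`.) -/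
noncomputable def squeezeSymmetry (𝕜 : Type) [RCLike 𝕜] : SystemParameter.{u} 𝕜 :=
  fun X _ _ _ _ S m =>
    sInf {C : ℝ≥0∞ | ∀ (f : X) (A B : Finset ℕ) (hB : B.Nonempty) (ε : ℕ → 𝕜),
      A.card = B.card → B.card ≤ m → S.IsGreedySet f B → IsSignOn ε A →
      ENNReal.ofReal (B.inf' hB (fun n => ‖S.dual n f‖) * ‖S.signedSum ε A‖) ≤
        C * ENNReal.ofReal ‖f‖}

/-- The disjoint squeeze symmetry parameter `λ_m^d`: as `λ_m`, with the additional requirement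
`A ∩ supp f = ∅`. -/
noncomputable def disjointSqueezeSymmetry (𝕜 : Type) [RCLike 𝕜] : SystemParameter.{u} 𝕜 :=
  fun X _ _ _ _ S m =>
    sInf {C : ℝ≥0∞ | ∀ (f : X) (A B : Finset ℕ) (hB : B.Nonempty) (ε : ℕ → 𝕜),
      A.card = B.card → B.card ≤ m → S.IsGreedySet f B → IsSignOn ε A →
      Disjoint (A : Set ℕ) (S.supp f) →
      ENNReal.ofReal (B.inf' hB (fun n => ‖S.dual n f‖) * ‖S.signedSum ε A‖) ≤
        C * ENNReal.ofReal ‖f‖}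

/-- The symmetry for largest coefficients parameter `ν_m`: the supremum of
`‖1_{ε,A} + f‖ / ‖1_{δ,B} + f‖` over `|A| = |B| ≤ m`, signs `ε`, `δ`, and `f` with
`max_n |xₙ*(f)| ≤ 1` and `supp f ∩ (A ∪ B) = ∅`. (The denominator vanishes only for `A = B = ∅`,
`f = 0`, where the quotient is read as `0`; this does not affect the supremum for `m ≥ 1`.) -/
noncomputable def largestCoeffSymmetry (𝕜 : Type) [RCLike 𝕜] : SystemParameter.{u} 𝕜 :=
  fun X _ _ _ _ S m =>
    sSup {r : ℝ≥0∞ | ∃ (f : X) (A B : Finset ℕ) (ε δ : ℕ → 𝕜),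
      A.card = B.card ∧ B.card ≤ m ∧ IsSignOn ε A ∧ IsSignOn δ B ∧
      (∀ n, ‖S.dual n f‖ ≤ 1) ∧ Disjoint (S.supp f) ((A ∪ B : Finset ℕ) : Set ℕ) ∧
      r = ENNReal.ofReal ‖S.signedSum ε A + f‖ / ENNReal.ofReal ‖S.signedSum δ B + f‖}

/-- `U_B(a_m, b_m)`: the real `R` such that, for every `p`-Banach space `X` (`0 < p ≤ 1` arbitrary)
and every fundamental minimal system of `X`, there is a finite `C` with
`sup_{m ≥ 1} a_m / b_m ^ R ≤ C`. -/
def exponentsB (𝕜 : Type) [RCLike 𝕜] (a b : SystemParameter.{u} 𝕜) : Set ℝ :=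
  {R | ∀ (p : ℝ) (X : Type u) [AddCommGroup X] [Module 𝕜 X] [UniformSpace X] [Norm X]
      [IsPBanachSpace 𝕜 p X] (S : FundamentalMinimalSystem 𝕜 X),
      ∃ C : ℝ≥0, ∀ m : ℕ, 1 ≤ m → a X S m / (b X S m) ^ R ≤ C}

/-- `U_M(a_m, b_m)`: the same with Markushevich bases only. -/
def exponentsM (𝕜 : Type) [RCLike 𝕜] (a b : SystemParameter.{u} 𝕜) : Set ℝ :=
  {R | ∀ (p : ℝ) (X : Type u) [AddCommGroup X] [Module 𝕜 X] [UniformSpace X] [Norm X]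
      [IsPBanachSpace 𝕜 p X] (S : FundamentalMinimalSystem 𝕜 X), S.IsMarkushevich →
      ∃ C : ℝ≥0, ∀ m : ℕ, 1 ≤ m → a X S m / (b X S m) ^ R ≤ C}

/-- `U_S(a_m, b_m)`: the same with Schauder bases only. -/
def exponentsS (𝕜 : Type) [RCLike 𝕜] (a b : SystemParameter.{u} 𝕜) : Set ℝ :=
  {R | ∀ (p : ℝ) (X : Type u) [AddCommGroup X] [Module 𝕜 X] [UniformSpace X] [Norm X]
      [IsPBanachSpace 𝕜 p X] (S : FundamentalMinimalSystem 𝕜 X), S.IsSchauder →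
      ∃ C : ℝ≥0, ∀ m : ℕ, 1 ≤ m → a X S m / (b X S m) ^ R ≤ C}

/-- The ratio function `R_B(a_m, b_m) = inf U_B(a_m, b_m)`, an extended real
(`∞` if there is no admissible exponent). -/
noncomputable def ratioB (𝕜 : Type) [RCLike 𝕜] (a b : SystemParameter.{u} 𝕜) : EReal :=
  sInf ((fun R : ℝ => (R : EReal)) '' exponentsB 𝕜 a b)

/-- The ratio function `R_M(a_m, b_m) = inf U_M(a_m, b_m)`. -/
noncomputable def ratioM (𝕜 : Type) [RCLike 𝕜] (a b : SystemParameter.{u} 𝕜) : EReal :=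
  sInf ((fun R : ℝ => (R : EReal)) '' exponentsM 𝕜 a b)

/-- The ratio function `R_S(a_m, b_m) = inf U_S(a_m, b_m)`. -/
noncomputable def ratioS (𝕜 : Type) [RCLike 𝕜] (a b : SystemParameter.{u} 𝕜) : EReal :=
  sInf ((fun R : ℝ => (R : EReal)) '' exponentsS 𝕜 a b)

/-! All the upper bounds go through `DominatesFlat`: if every signed sum over |B| positions is at
most L‖g‖ whenever g has its largest coefficients, of modulus one, on B, then ν_m ≤ 3^(1/p) L.
Indeed, with g = 1_{δ,B} + f one has 1_{ε,A} + f = 1_{ε,A} - 1_{δ,B} + g, and each of the three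
terms is at most L‖g‖. The parameter λ_m gives such an L directly, up to a factor 2, hence the
exponent 1.

For λ_m^d, a set A that meets supp f is reached through a third set D of the same size, disjoint
from both A and supp f: 1_{ε,A} is dominated by 1_D, and 1_D by f. Two applications give the square,
hence the exponent 2. Such a D exists once f is replaced by a vector of finite support
(`exists_finite_supp_approx`). For a Schauder basis one application is enough: cut ℕ at a point j
that halves B. The part of A beyond j is disjoint from the support of the head of f, which still
carries half of B, and symmetrically for the tail (`DominatesDisjoint.dominatesFlat_of_isSchauder`).

Both lower bounds use Banach spaces, p = 1. In the ℓ₂-sum of the spaces ℓ₁^{k+1}, a full block of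
length m has norm m, while a transversal of m blocks has norm √m; so ν_m ≥ √m, and also λ_m ≤ √m.
This Schauder basis excludes exponents below 1.

The exponent 2 is forced in a Hilbert space, a sum of Euclidean blocks. With Q_k = 2^(k!), block k
has dimension Q_{k+1}². Its unit vector basis is distorted by shrinking the normalized constant
vector by Q_k/Q_{k+1} and stretching, by the inverse factor, a vector with opposite signs on the two
halves. Flipping the signs on one half of block i then multiplies the norm of the sum over the block
by (Q_{i+1}/Q_i)², a lower bound for ν_m with m = Q_{i+1}²/2. At the same m, λ_m^d ≤ 54 Q_{i+1}: a
vector that is small because its coefficients are nearly constant on block i is large at most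
positions of that block, which leaves few positions there for a disjoint A
(`card_blockPart_le_of_dual_eq_zero`). As Q_{i+1} = Q_i^{i+1}, the factor Q_i² is negligible in the
exponent, and 2 results. -/

namespace IsPBanachSpace

/-! ### Quasi-norm inequalities. -/

variable (𝕜 : Type*) [RCLike 𝕜] (p : ℝ) {X : Type*} [AddCommGroup X] [Module 𝕜 X]
  [UniformSpace X] [Norm X] [hX : IsPBanachSpace 𝕜 p X]

include hX

theorem qnorm_zero : ‖(0 : X)‖ = 0 := (hX.norm_eq_zero_iff 0).2 rfl

theorem qnorm_neg (f : X) : ‖-f‖ = ‖f‖ := by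
  have h := hX.norm_smul (-1) f
  simpa using h

theorem le_of_rpow_le {f : X} {r M : ℝ} (hr : 0 ≤ r) (hM : 0 ≤ M)
    (h : ‖f‖ ^ p ≤ r * M ^ p) : ‖f‖ ≤ r ^ p⁻¹ * M := by
  have hp := hX.p_pos
  refine (Real.rpow_le_rpow_iff (hX.norm_nonneg f) (by positivity) hp).1 ?_
  rwa [Real.mul_rpow (by positivity) hM, Real.rpow_inv_rpow hr hp.ne']

theorem rpow_sum_le {ι : Type*} (s : Finset ι) (g : ι → X) :
    ‖∑ i ∈ s, g i‖ ^ p ≤ ∑ i ∈ s, ‖g i‖ ^ p := by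
  classical
  induction s using Finset.induction_on with
  | empty => simp [qnorm_zero 𝕜 p, Real.zero_rpow hX.p_pos.ne']
  | insert a s ha ih =>
    rw [Finset.sum_insert ha, Finset.sum_insert ha]
    exact (hX.norm_add_rpow_le _ _).trans (by gcongr)

theorem norm_sum_le {ι : Type*} (s : Finset ι) (g : ι → X) {M : ℝ} (hM : 0 ≤ M)
    (h : ∀ i ∈ s, ‖g i‖ ≤ M) : ‖∑ i ∈ s, g i‖ ≤ (s.card : ℝ) ^ p⁻¹ * M := by
  refine le_of_rpow_le 𝕜 p (by positivity) hM ((rpow_sum_le 𝕜 p s g).trans ?_)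
  calc ∑ i ∈ s, ‖g i‖ ^ p ≤ ∑ _i ∈ s, M ^ p := Finset.sum_le_sum fun i hi =>
        Real.rpow_le_rpow (hX.norm_nonneg _) (h i hi) hX.p_pos.le
    _ = s.card * M ^ p := by simp

theorem norm_add_le_two {f g : X} {M : ℝ} (hf : ‖f‖ ≤ M) (hg : ‖g‖ ≤ M) :
    ‖f + g‖ ≤ (2 : ℝ) ^ p⁻¹ * M := by
  have := norm_sum_le 𝕜 p (Finset.univ : Finset (Fin 2)) ![f, g]
    ((hX.norm_nonneg f).trans hf) (by intro i _; fin_cases i <;> simpa)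
  simpa using this

theorem exists_norm_sub_lt {s : Set X} (hs : Dense s) (f : X) {η : ℝ} (hη : 0 < η) :
    ∃ g ∈ s, ‖g - f‖ < η := by
  have hn : {g : X | ‖g - f‖ < η} ∈ nhds f := by
    refine UniformSpace.mem_nhds_iff_symm.2 ?_
    refine ⟨{q : X × X | ‖q.1 - q.2‖ < η}, hX.uniformity_hasBasis.mem_of_mem hη, ?_, ?_⟩
    · constructor
      intro a b h
      change ‖b - a‖ < η
      rw [← neg_sub, qnorm_neg 𝕜 p]; exact h
    · intro g hg
      change ‖f - g‖ < η at hg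
      change ‖g - f‖ < η
      rwa [← neg_sub, qnorm_neg 𝕜 p]
  obtain ⟨g, hg, hgs⟩ := mem_closure_iff_nhds.1 (hs f) _ hn
  exact ⟨g, hgs, hg⟩

end IsPBanachSpace

/-! ### Coordinates of finite sums and uniform bounds. -/

namespace FundamentalMinimalSystem

open IsPBanachSpace

section Basic

variable {𝕜 : Type*} [RCLike 𝕜] {X : Type*} [AddCommGroup X] [Module 𝕜 X]
  [UniformSpace X] [Norm X] (S : FundamentalMinimalSystem 𝕜 X)

theorem dual_sum_smul (A : Finset ℕ) (c : ℕ → 𝕜) (n : ℕ) :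
    S.dual n (∑ i ∈ A, c i • S.vec i) = if n ∈ A then c n else 0 := by
  simp [S.biorthogonal]

theorem dual_signedSum (ε : ℕ → 𝕜) (A : Finset ℕ) (n : ℕ) :
    S.dual n (S.signedSum ε A) = if n ∈ A then ε n else 0 := S.dual_sum_smul A ε n

theorem dual_proj (A : Finset ℕ) (f : X) (n : ℕ) :
    S.dual n (S.proj A f) = if n ∈ A then S.dual n f else 0 :=
  S.dual_sum_smul A (fun k => S.dual k f) n

theorem vec_ne_zero (n : ℕ) : S.vec n ≠ 0 := by
  intro h
  have := S.biorthogonal n n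
  simp [h] at this

theorem signedSum_union {A B : Finset ℕ} (h : Disjoint A B) (ε : ℕ → 𝕜) :
    S.signedSum ε (A ∪ B) = S.signedSum ε A + S.signedSum ε B :=
  Finset.sum_union h

end Basic

section Quasi

variable {𝕜 : Type*} [RCLike 𝕜] (p : ℝ) {X : Type*} [AddCommGroup X] [Module 𝕜 X]
  [UniformSpace X] [Norm X] [hX : IsPBanachSpace 𝕜 p X] (S : FundamentalMinimalSystem 𝕜 X)

include hX

theorem exists_bounds : ∃ V D : ℝ, 1 ≤ V ∧ 1 ≤ D ∧ (∀ n, ‖S.vec n‖ ≤ V) ∧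
    ∀ n f, ‖S.dual n f‖ ≤ D * ‖f‖ := by
  obtain ⟨V, hV⟩ := S.vec_bounded
  obtain ⟨D, hD⟩ := S.dual_bounded
  refine ⟨max V 1, max D 1, le_max_right _ _, le_max_right _ _,
    fun n => (hV n).trans (le_max_left _ _), fun n f => (hD n f).trans ?_⟩
  have := hX.norm_nonneg f
  gcongr
  exact le_max_left _ _

theorem norm_vec_pos (n : ℕ) : 0 < ‖S.vec n‖ :=
  lt_of_le_of_ne (hX.norm_nonneg _)
    fun h => S.vec_ne_zero n ((hX.norm_eq_zero_iff _).1 h.symm)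

end Quasi

end FundamentalMinimalSystem

/-- Signed sums over sets `A` disjoint from the support of `f`, not larger than the set `B` of
positions of the largest coefficients of `f`, are dominated by `L • f`. -/
def DominatesDisjoint {𝕜 : Type*} [RCLike 𝕜] {X : Type*} [AddCommGroup X] [Module 𝕜 X]
    [UniformSpace X] [Norm X] (S : FundamentalMinimalSystem 𝕜 X) (m : ℕ) (L : ℝ) : Prop :=
  ∀ (f : X) (A B : Finset ℕ) (ε : ℕ → 𝕜) (t : ℝ), 1 ≤ t → A.card ≤ B.card → B.card ≤ m →
    (∀ n, ‖S.dual n f‖ ≤ t) → (∀ n ∈ B, ‖S.dual n f‖ = t) → IsSignOn ε A →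
    Disjoint (A : Set ℕ) (S.supp f) → ‖S.signedSum ε A‖ ≤ L * ‖f‖

/-- Signed sums over sets `A` as large as the set `B` of positions of the largest coefficients of
`f`, all of modulus one, are dominated by `L • f`. -/
def DominatesFlat {𝕜 : Type*} [RCLike 𝕜] {X : Type*} [AddCommGroup X] [Module 𝕜 X]
    [UniformSpace X] [Norm X] (S : FundamentalMinimalSystem 𝕜 X) (m : ℕ) (L : ℝ) : Prop :=
  ∀ (f : X) (A B : Finset ℕ) (ε : ℕ → 𝕜), A.card = B.card → B.card ≤ m →
    (∀ n, ‖S.dual n f‖ ≤ 1) → (∀ n ∈ B, ‖S.dual n f‖ = 1) → IsSignOn ε A →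
    ‖S.signedSum ε A‖ ≤ L * ‖f‖

/-! ### From the parameters to domination constants. -/

section Upper

open FundamentalMinimalSystem IsPBanachSpace

variable {𝕜 : Type} [RCLike 𝕜] (p : ℝ) {X : Type u} [AddCommGroup X] [Module 𝕜 X]
  [UniformSpace X] [Norm X] [hX : IsPBanachSpace 𝕜 p X] (S : FundamentalMinimalSystem 𝕜 X)

include hX

theorem largestCoeffSymmetry_le {m : ℕ} {L : ℝ} (hL : 1 ≤ L) (h : DominatesFlat S m L) :
    largestCoeffSymmetry 𝕜 X S m ≤ ENNReal.ofReal ((3 : ℝ) ^ p⁻¹ * L) := by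
  refine sSup_le ?_
  rintro r ⟨f, A, B, ε, δ, hAB, hBm, hε, hδ, hf, hd, rfl⟩
  refine ENNReal.div_le_of_le_mul ?_
  have hp := hX.p_pos
  rw [← ENNReal.ofReal_mul (by positivity)]
  refine ENNReal.ofReal_le_ofReal ?_
  set g := S.signedSum δ B + f with hg
  have hfB : ∀ n ∈ B, S.dual n f = 0 := by
    intro n hn
    by_contra hne
    exact Set.disjoint_left.1 hd (show n ∈ S.supp f from hne) (by simp [hn])
  have hg1 : ∀ n ∈ B, ‖S.dual n g‖ = 1 := by
    intro n hn
    rw [hg, map_add, S.dual_signedSum, if_pos hn, hfB n hn, add_zero, hδ n hn]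
  have hg2 : ∀ n, ‖S.dual n g‖ ≤ 1 := by
    intro n
    by_cases hn : n ∈ B
    · exact (hg1 n hn).le
    · rw [hg, map_add, S.dual_signedSum, if_neg hn, zero_add]; exact hf n
  have h1 := h g A B ε hAB hBm hg2 hg1 hε
  have h2 := h g B B δ rfl hBm hg2 hg1 hδ
  have h3 : ‖g‖ ≤ L * ‖g‖ := le_mul_of_one_le_left (hX.norm_nonneg g) hL
  have key := norm_sum_le 𝕜 p (Finset.univ : Finset (Fin 3))
    ![S.signedSum ε A, -S.signedSum δ B, g] (M := L * ‖g‖)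
    (mul_nonneg (by linarith) (hX.norm_nonneg g)) (by
      intro i _
      fin_cases i
      · simpa using h1
      · simpa [qnorm_neg 𝕜 p] using h2
      · simpa using h3)
  have e : ∑ i : Fin 3, ![S.signedSum ε A, -S.signedSum δ B, g] i = S.signedSum ε A + f := by
    simp [Fin.sum_univ_three, hg]
  rw [e] at key
  simpa [mul_assoc] using key

/-- Testing with f a single basis vector gives ‖x_i‖ ≤ C‖x_j‖ for i ≠ j; exchanging i and j forces C
≥ 1. -/
theorem one_le_disjointSqueezeSymmetry {m : ℕ} (hm : 1 ≤ m) :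
    1 ≤ disjointSqueezeSymmetry 𝕜 X S m := by
  refine le_sInf ?_
  intro C hC
  have key : ∀ i j : ℕ, i ≠ j →
      ENNReal.ofReal ‖S.vec i‖ ≤ C * ENNReal.ofReal ‖S.vec j‖ := by
    intro i j hij
    have := hC (S.vec j) {i} {j} (by simp) (fun _ => 1) (by simp) (by simpa using hm)
      (by
        intro n hn k hk
        simp only [Finset.mem_singleton] at hn hk
        simp [S.biorthogonal, hk])
      (by intro n _; simp)
      (by
        simp [supp, S.biorthogonal, hij])
    simpa [signedSum, S.biorthogonal] using this
  have h0 := norm_vec_pos p S 0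
  have h1 := norm_vec_pos p S 1
  by_contra hlt
  rw [not_le] at hlt
  rcases le_total ‖S.vec 0‖ ‖S.vec 1‖ with h | h
  · have a := key 1 0 (by simp)
    have : C * ENNReal.ofReal ‖S.vec 0‖ < 1 * ENNReal.ofReal ‖S.vec 0‖ :=
      ENNReal.mul_lt_mul_left (by simpa using h0) (by simp) hlt
    rw [one_mul] at this
    exact absurd (a.trans_lt this) (not_lt.2 (ENNReal.ofReal_le_ofReal h))
  · have a := key 0 1 (by simp)
    have : C * ENNReal.ofReal ‖S.vec 1‖ < 1 * ENNReal.ofReal ‖S.vec 1‖ :=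
      ENNReal.mul_lt_mul_left (by simpa using h1) (by simp) hlt
    rw [one_mul] at this
    exact absurd (a.trans_lt this) (not_lt.2 (ENNReal.ofReal_le_ofReal h))

omit hX in
theorem disjointSqueezeSymmetry_le_squeezeSymmetry (m : ℕ) :
    disjointSqueezeSymmetry 𝕜 X S m ≤ squeezeSymmetry 𝕜 X S m :=
  sInf_le_sInf fun _ hC f A B hB ε h1 h2 h3 h4 _ => hC f A B hB ε h1 h2 h3 h4

theorem one_le_squeezeSymmetry {m : ℕ} (hm : 1 ≤ m) : 1 ≤ squeezeSymmetry 𝕜 X S m :=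
  (one_le_disjointSqueezeSymmetry p S hm).trans (disjointSqueezeSymmetry_le_squeezeSymmetry S m)

theorem exists_dominatesFlat {m : ℕ} (hm : 1 ≤ m) (hfin : squeezeSymmetry 𝕜 X S m ≠ ⊤) :
    ∃ L : ℝ, 1 ≤ L ∧ ENNReal.ofReal L ≤ 2 * squeezeSymmetry 𝕜 X S m ∧ DominatesFlat S m L := by
  have h1 := one_le_squeezeSymmetry p S hm
  -- Doubling avoids proving that the infimum is attained; it is strict because the parameter is
  -- finite and at least 1.
  have hlt : squeezeSymmetry 𝕜 X S m < 2 * squeezeSymmetry 𝕜 X S m := by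
    rw [two_mul]
    exact ENNReal.lt_add_right hfin (by positivity)
  obtain ⟨C, hC, hC2⟩ := sInf_lt_iff.1 hlt
  have hCtop : C ≠ ⊤ := ne_top_of_lt hC2
  have hC1 : 1 ≤ C := h1.trans (sInf_le hC)
  refine ⟨C.toReal, ?_, ?_, ?_⟩
  · rw [← ENNReal.toReal_one]; exact ENNReal.toReal_mono hCtop hC1
  · rw [ENNReal.ofReal_toReal hCtop]; exact hC2.le
  · intro f A B ε hAB hBm hf hB hε
    rcases B.eq_empty_or_nonempty with rfl | hne
    · have : A = ∅ := Finset.card_eq_zero.1 (by simpa using hAB)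
      subst this
      simp only [signedSum, Finset.sum_empty, qnorm_zero 𝕜 p]
      exact mul_nonneg ENNReal.toReal_nonneg (hX.norm_nonneg f)
    · have := hC f A B hne ε hAB hBm (fun n hn k _ => (hf k).trans (hB n hn).ge) hε
      have hinf : B.inf' hne (fun n => ‖S.dual n f‖) = 1 := by
        rw [Finset.inf'_congr hne rfl hB, Finset.inf'_const]
      rw [hinf, one_mul, ← ENNReal.ofReal_toReal hCtop,
        ← ENNReal.ofReal_mul ENNReal.toReal_nonneg] at this
      exact (ENNReal.ofReal_le_ofReal_iff
        (mul_nonneg ENNReal.toReal_nonneg (hX.norm_nonneg f))).1 this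

theorem exists_dominatesDisjoint {m : ℕ} (hm : 1 ≤ m)
    (hfin : disjointSqueezeSymmetry 𝕜 X S m ≠ ⊤) :
    ∃ L : ℝ, 1 ≤ L ∧ ENNReal.ofReal L ≤ 2 * disjointSqueezeSymmetry 𝕜 X S m ∧
      DominatesDisjoint S m L := by
  have h1 := one_le_disjointSqueezeSymmetry p S hm
  have hlt : disjointSqueezeSymmetry 𝕜 X S m < 2 * disjointSqueezeSymmetry 𝕜 X S m := by
    rw [two_mul]
    exact ENNReal.lt_add_right hfin (by positivity)
  obtain ⟨C, hC, hC2⟩ := sInf_lt_iff.1 hlt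
  have hCtop : C ≠ ⊤ := ne_top_of_lt hC2
  have hC1 : 1 ≤ C := h1.trans (sInf_le hC)
  refine ⟨C.toReal, ?_, ?_, ?_⟩
  · rw [← ENNReal.toReal_one]; exact ENNReal.toReal_mono hCtop hC1
  · rw [ENNReal.ofReal_toReal hCtop]; exact hC2.le
  · intro f A B₀ ε t ht hAB₀ hBm₀ hf hB₀ hε hd
    obtain ⟨B, hBB, hAB⟩ := Finset.exists_subset_card_eq hAB₀
    have hB : ∀ n ∈ B, ‖S.dual n f‖ = t := fun n hn => hB₀ n (hBB hn)
    have hBm : B.card ≤ m := (Finset.card_le_card hBB).trans hBm₀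
    rcases B.eq_empty_or_nonempty with rfl | hne
    · have : A = ∅ := Finset.card_eq_zero.1 (by simpa using hAB.symm)
      subst this
      simp only [signedSum, Finset.sum_empty, qnorm_zero 𝕜 p]
      exact mul_nonneg ENNReal.toReal_nonneg (hX.norm_nonneg f)
    · have := hC f A B hne ε hAB.symm hBm (fun n hn k _ => (hf k).trans (hB n hn).ge) hε hd
      have hinf : B.inf' hne (fun n => ‖S.dual n f‖) = t := by
        rw [Finset.inf'_congr hne rfl hB, Finset.inf'_const]
      rw [hinf, ← ENNReal.ofReal_toReal hCtop,
        ← ENNReal.ofReal_mul ENNReal.toReal_nonneg] at this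
      have := (ENNReal.ofReal_le_ofReal_iff
        (mul_nonneg ENNReal.toReal_nonneg (hX.norm_nonneg f))).1 this
      exact (le_mul_of_one_le_left (hX.norm_nonneg _) ht).trans this

end Upper

/-! ### From disjoint domination to flat domination. -/

section Upper

open FundamentalMinimalSystem IsPBanachSpace

variable {𝕜 : Type} [RCLike 𝕜] (p : ℝ) {X : Type u} [AddCommGroup X] [Module 𝕜 X]
  [UniformSpace X] [Norm X] [hX : IsPBanachSpace 𝕜 p X] (S : FundamentalMinimalSystem 𝕜 X)

include hX

/-- Approximation of `f` by a vector with finite support that keeps the position of the largest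
coefficients. -/
theorem exists_finite_supp_approx (f : X) {B : Finset ℕ} (hne : B.Nonempty)
    (hf : ∀ n, ‖S.dual n f‖ ≤ 1) (hB : ∀ n ∈ B, ‖S.dual n f‖ = 1) :
    ∃ (h : X) (t : ℝ), 1 ≤ t ∧ (S.supp h).Finite ∧ (∀ n, ‖S.dual n h‖ ≤ t) ∧
      (∀ n ∈ B, ‖S.dual n h‖ = t) ∧ ‖h‖ ≤ (2 : ℝ) ^ p⁻¹ * ‖f‖ := by
  classical
  obtain ⟨V, D, hV1, hD1, hV, hD⟩ := exists_bounds p S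
  have hp := hX.p_pos
  obtain ⟨b, hb⟩ := hne
  have hfpos : 0 < ‖f‖ := by
    have := hD b f
    rw [hB b hb] at this
    by_contra hcon
    have h0 := hX.norm_nonneg f
    have h1 : ‖f‖ = 0 := by linarith
    rw [h1] at this
    linarith
  -- Below, h - f is a sum of |B| + 1 terms, each at most (1 + 2DV)η, so η = ‖f‖ / M gives ‖h - f‖ ≤
  -- ‖f‖.
  set M : ℝ := ((B.card + 1 : ℕ) : ℝ) ^ p⁻¹ * (1 + 2 * D * V) with hM
  have hMpos : 0 < M := by positivity
  set η : ℝ := ‖f‖ / M with hη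
  have hηpos : 0 < η := by positivity
  obtain ⟨g, hgs, hg⟩ := exists_norm_sub_lt 𝕜 p S.dense_span f hηpos
  obtain ⟨c, rfl⟩ := Finsupp.mem_span_range_iff_exists_finsupp.1 hgs
  set g : X := c.sum fun i a => a • S.vec i with hgdef
  have hcg : ∀ n, S.dual n g = c n := by
    intro n
    have : g = ∑ i ∈ c.support, c i • S.vec i := rfl
    rw [this, S.dual_sum_smul]
    simp only [Finsupp.mem_support_iff, ite_not]
    split_ifs with h
    · exact h.symm
    · rfl
  have hcf : ∀ n, ‖c n - S.dual n f‖ ≤ D * η := by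
    intro n
    rw [← hcg, ← map_sub]
    exact (hD n _).trans (by gcongr)
  -- The level t bounds every coefficient of g. Resetting the coefficients on B to modulus t keeps B
  -- a set of largest coefficients; this is why `DominatesDisjoint` allows levels above 1.
  set t : ℝ := 1 + D * η with ht
  have ht1 : 1 ≤ t := by rw [ht]; nlinarith
  set h : X := g + ∑ n ∈ B, (S.dual n f * (t : 𝕜) - c n) • S.vec n with hh
  have hdual : ∀ n, S.dual n h = if n ∈ B then S.dual n f * (t : 𝕜) else c n := by
    intro n
    rw [hh, map_add, S.dual_sum_smul, hcg]
    split_ifs <;> ring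
  have hBt : ∀ n ∈ B, ‖S.dual n h‖ = t := by
    intro n hn
    rw [hdual, if_pos hn, norm_mul, hB n hn, one_mul, RCLike.norm_ofReal, abs_of_pos (by linarith)]
  refine ⟨h, t, ht1, ?_, ?_, hBt, ?_⟩
  · refine (c.support ∪ B).finite_toSet.subset ?_
    intro n hn
    by_contra hcon
    simp only [Finset.coe_union, Set.mem_union, Finset.mem_coe, Finsupp.mem_support_iff,
      not_or, not_not] at hcon
    exact hn (by rw [hdual, if_neg hcon.2, hcon.1])
  · intro n
    by_cases hn : n ∈ B
    · exact (hBt n hn).le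
    · rw [hdual, if_neg hn]
      calc ‖c n‖ = ‖S.dual n f + (c n - S.dual n f)‖ := by congr 1; ring
        _ ≤ ‖S.dual n f‖ + ‖c n - S.dual n f‖ := norm_add_le _ _
        _ ≤ t := add_le_add (hf n) (hcf n)
  · have hcoef : ∀ n ∈ B, ‖S.dual n f * (t : 𝕜) - c n‖ ≤ 2 * D * η := by
      intro n hn
      have : S.dual n f * (t : 𝕜) - c n
          = (S.dual n f - c n) + S.dual n f * ((D * η : ℝ) : 𝕜) := by
        rw [ht]; push_cast; ring
      rw [this]
      refine (norm_add_le _ _).trans ?_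
      rw [norm_mul, hB n hn, norm_sub_rev, RCLike.norm_ofReal, abs_of_nonneg (by positivity)]
      linarith [hcf n]
    have hdiff : ‖h - f‖ ≤ ‖f‖ := by
      have := IsPBanachSpace.norm_sum_le 𝕜 p (Finset.insertNone B)
        (fun o : Option ℕ => o.elim (g - f) fun n => (S.dual n f * (t : 𝕜) - c n) • S.vec n)
        (M := (1 + 2 * D * V) * η) (by positivity) (by
          rintro (_ | n) hn
          · simp only [Option.elim_none]
            refine hg.le.trans ?_
            have : 0 ≤ 2 * D * V * η := by positivity
            linarith
          · simp only [Finset.mem_insertNone, Option.mem_def, Option.some.injEq,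
              forall_eq'] at hn
            simp only [Option.elim_some]
            rw [hX.norm_smul]
            calc _ ≤ 2 * D * η * V := mul_le_mul (hcoef n hn) (hV n) (hX.norm_nonneg _)
                  (by positivity)
              _ ≤ _ := by linarith)
      rw [Finset.sum_insertNone, Finset.card_insertNone] at this
      simp only [Option.elim_none, Option.elim_some] at this
      have e : g - f + ∑ n ∈ B, (S.dual n f * (t : 𝕜) - c n) • S.vec n = h - f := by
        rw [hh]; abel
      rw [e] at this
      refine this.trans ?_
      rw [← mul_assoc, ← hM, hη]
      exact le_of_eq (by field_simp)
    have := norm_add_le_two 𝕜 p hdiff (le_refl ‖f‖)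
    simpa using this

theorem DominatesDisjoint.dominatesFlat {m : ℕ} {L : ℝ} (hL : 1 ≤ L)
    (h : DominatesDisjoint S m L) : DominatesFlat S m ((2 : ℝ) ^ p⁻¹ * L ^ 2) := by
  classical
  have hp := hX.p_pos
  intro f A B ε hAB hBm hf hB hε
  rcases B.eq_empty_or_nonempty with rfl | hne
  · have : A = ∅ := Finset.card_eq_zero.1 (by simpa using hAB)
    subst this
    simp only [signedSum, Finset.sum_empty, qnorm_zero 𝕜 p]
    exact mul_nonneg (by positivity) (hX.norm_nonneg f)
  obtain ⟨g, t, ht, hfin, hgt, hgB, hg⟩ := exists_finite_supp_approx p S f hne hf hB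
  -- D is the intermediate set, disjoint from A and from the finite support of g.
  obtain ⟨D, hD, hDc⟩ := Set.Infinite.exists_subset_card_eq
    ((hfin.union A.finite_toSet).infinite_compl) B.card
  have hDsub : ∀ n ∈ D, S.dual n g = 0 ∧ n ∉ A := by
    intro n hn
    have := hD hn
    simpa [supp] using this
  have h1 : ‖S.signedSum (fun _ => 1) D‖ ≤ L * ‖g‖ :=
    h g D B (fun _ => 1) t ht hDc.le hBm hgt hgB (by intro n _; simp)
      (Set.disjoint_left.2 fun n hn hs => hs (hDsub n hn).1)
  have h2 : ‖S.signedSum ε A‖ ≤ L * ‖S.signedSum (fun _ => 1) D‖ := by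
    refine h _ A D ε 1 le_rfl (by omega) (by omega) ?_ ?_ hε ?_
    · intro n
      rw [S.dual_signedSum]
      split_ifs <;> simp
    · intro n hn
      rw [S.dual_signedSum, if_pos hn, norm_one]
    · refine Set.disjoint_left.2 fun n hn hs => hs ?_
      rw [S.dual_signedSum, if_neg fun hnD => (hDsub n hnD).2 hn]
  calc _ ≤ L * ‖S.signedSum (fun _ => 1) D‖ := h2
    _ ≤ L * (L * ((2 : ℝ) ^ p⁻¹ * ‖f‖)) := by gcongr; exact h1.trans (by gcongr)
    _ = _ := by ring

/-- Cut A into r pieces of size at most |B|, dominate each one by f and add with p-subadditivity. -/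
theorem DominatesDisjoint.rpow_le {m : ℕ} {L : ℝ} (hL : 1 ≤ L) (h : DominatesDisjoint S m L)
    {f : X} {B : Finset ℕ} (hBm : B.card ≤ m)
    (hf : ∀ n, ‖S.dual n f‖ ≤ 1) (hB : ∀ n ∈ B, ‖S.dual n f‖ = 1) (ε : ℕ → 𝕜) (r : ℕ)
    (A : Finset ℕ) (hA : A.card ≤ r * B.card) (hε : IsSignOn ε A)
    (hd : Disjoint (A : Set ℕ) (S.supp f)) :
    ‖S.signedSum ε A‖ ^ p ≤ r * (L * ‖f‖) ^ p := by
  classical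
  have hp := hX.p_pos
  have h0 := hX.norm_nonneg f
  induction r generalizing A with
  | zero =>
    have : A = ∅ := Finset.card_eq_zero.1 (by simpa using hA)
    subst this
    simp [signedSum, qnorm_zero 𝕜 p, Real.zero_rpow hp.ne']
  | succ r ih =>
    have key : ∀ A' ⊆ A, A'.card ≤ B.card → ‖S.signedSum ε A'‖ ^ p ≤ (L * ‖f‖) ^ p := by
      intro A' hA' hc
      refine Real.rpow_le_rpow (hX.norm_nonneg _) ?_ hp.le
      exact h f A' B ε 1 le_rfl hc hBm hf hB (fun n hn => hε n (hA' hn))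
        (hd.mono_left (by exact_mod_cast hA'))
    rcases le_total A.card B.card with hle | hle
    · refine (key A subset_rfl hle).trans ?_
      have : 0 ≤ (L * ‖f‖) ^ p := by positivity
      push_cast
      nlinarith [mul_nonneg (Nat.cast_nonneg (α := ℝ) r) this]
    · obtain ⟨A', hA', hc⟩ := Finset.exists_subset_card_eq hle
      have e : S.signedSum ε A = S.signedSum ε (A \ A') + S.signedSum ε A' := by
        rw [← S.signedSum_union Finset.sdiff_disjoint, Finset.sdiff_union_of_subset hA']
      rw [e]
      refine (hX.norm_add_rpow_le _ _).trans ?_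
      have i1 := ih (A \ A') (by
        rw [Finset.card_sdiff_of_subset hA', hc]
        have : (r + 1) * B.card = r * B.card + B.card := by ring
        omega) (fun n hn => hε n (Finset.sdiff_subset hn))
        (hd.mono_left (by exact_mod_cast Finset.sdiff_subset))
      have i2 := key A' hA' hc.le
      push_cast
      linarith

omit hX in
-- A discrete intermediate value argument: the count increases by at most one when j does.
theorem Finset.exists_card_filter_lt_eq (B : Finset ℕ) {h : ℕ} (hh : h ≤ B.card) :
    ∃ j, (B.filter (· < j)).card = h := by
  have hex : ∃ j, h ≤ (B.filter (· < j)).card := by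
    refine ⟨B.sup id + 1, hh.trans (le_of_eq ?_)⟩
    rw [Finset.filter_true_of_mem]
    intro n hn
    exact Nat.lt_succ_of_le (Finset.le_sup (f := id) hn)
  classical
  refine ⟨Nat.find hex, le_antisymm ?_ (Nat.find_spec hex)⟩
  rcases hj : Nat.find hex with _ | j
  · simp
  · have h1 := Nat.find_min hex (m := j) (by omega)
    have h2 : B.filter (· < j + 1) ⊆ insert j (B.filter (· < j)) := by
      intro n hn
      simp only [Finset.mem_filter, Finset.mem_insert] at hn ⊢
      rcases hn with ⟨a, b⟩
      by_cases n = j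
      · left; assumption
      · right; exact ⟨a, by omega⟩
    have h3 := (Finset.card_le_card h2).trans (Finset.card_insert_le _ _)
    omega

theorem DominatesDisjoint.dominatesFlat_of_isSchauder (hS : S.IsSchauder) :
    ∃ K : ℝ, 1 ≤ K ∧ ∀ (m : ℕ) (L : ℝ), 1 ≤ L → DominatesDisjoint S m L →
      DominatesFlat S m (K * L) := by
  classical
  obtain ⟨V, D, hV1, hD1, hV, hD⟩ := exists_bounds p S
  obtain ⟨K₀, hK₀⟩ := hS.2
  have hp := hX.p_pos
  set K := max K₀ 1 with hKdef
  have hK1 : 1 ≤ K := le_max_right _ _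
  have hK : ∀ m f, ‖S.proj (Finset.range m) f‖ ≤ K * ‖f‖ := fun m f =>
    (hK₀ m f).trans (by have := hX.norm_nonneg f; gcongr; exact le_max_left _ _)
  have h2p : (1 : ℝ) ≤ 2 ^ p⁻¹ := Real.one_le_rpow (by norm_num) (by positivity)
  set K₁ : ℝ := (2 : ℝ) ^ p⁻¹ * K with hK₁
  have hK₁1 : 1 ≤ K₁ := one_le_mul_of_one_le_of_one_le h2p hK1
  have hKK : K ≤ K₁ := le_mul_of_one_le_left (by linarith) h2p
  refine ⟨max ((6 : ℝ) ^ p⁻¹ * K₁) (V * D), ?_, ?_⟩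
  · exact le_max_of_le_right (one_le_mul_of_one_le_of_one_le hV1 hD1)
  intro m L hL h f A B ε hAB hBm hf hB hε
  have hf0 := hX.norm_nonneg f
  -- A set B with fewer than two elements has an empty half, so this case uses only the bounds V and
  -- D.
  rcases Nat.lt_or_ge B.card 2 with hlt | hge
  · have hle : ‖S.signedSum ε A‖ ≤ V * D * ‖f‖ := by
      rcases Nat.lt_or_ge B.card 1 with h0 | h1
      · have : A = ∅ := Finset.card_eq_zero.1 (by omega)
        subst this
        simp only [signedSum, Finset.sum_empty, qnorm_zero 𝕜 p]
        positivity
      · obtain ⟨a, rfl⟩ := Finset.card_eq_one.1 (show A.card = 1 by omega)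
        obtain ⟨b, rfl⟩ := Finset.card_eq_one.1 (show B.card = 1 by omega)
        have hb := hD b f
        rw [hB b (by simp)] at hb
        simp only [signedSum, Finset.sum_singleton]
        rw [hX.norm_smul, hε a (by simp), one_mul, mul_assoc]
        exact (hV a).trans (le_mul_of_one_le_right (by linarith) hb)
    refine hle.trans ?_
    refine mul_le_mul_of_nonneg_right ((le_max_right _ _).trans
      (le_mul_of_one_le_right (le_max_of_le_right (by positivity)) hL)) hf0
  obtain ⟨j, hj⟩ := Finset.exists_card_filter_lt_eq B (h := B.card / 2) (by omega)
  set f₁ := S.proj (Finset.range j) f with hf₁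
  set f₂ := f - f₁ with hf₂
  have d₁ : ∀ n, S.dual n f₁ = if n < j then S.dual n f else 0 := by
    intro n; rw [hf₁, S.dual_proj]; simp
  have d₂ : ∀ n, S.dual n f₂ = if n < j then 0 else S.dual n f := by
    intro n; rw [hf₂, map_sub, d₁]; split_ifs <;> simp
  have n₁ : ‖f₁‖ ≤ K₁ * ‖f‖ := (hK j f).trans (by gcongr)
  have n₂ : ‖f₂‖ ≤ K₁ * ‖f‖ := by
    have := norm_add_le_two 𝕜 p (f := f) (g := -f₁) (M := K * ‖f‖)
      (le_mul_of_one_le_left hf0 hK1) (by rw [qnorm_neg 𝕜 p]; exact hK j f)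
    rw [← sub_eq_add_neg] at this
    rw [hK₁, mul_assoc]
    exact this
  have hBc : (B.filter (· < j)).card + (B.filter (¬ · < j)).card = B.card :=
    Finset.card_filter_add_card_filter_not _
  have hAc : (A.filter (· < j)).card + (A.filter (¬ · < j)).card = A.card :=
    Finset.card_filter_add_card_filter_not _
  -- Three copies of the head of B cover A, since |B| ≤ 3⌊|B|/2⌋ once |B| ≥ 2.
  have b₁ : ‖S.signedSum ε (A.filter (¬ · < j))‖ ^ p ≤ (3 : ℕ) * (L * ‖f₁‖) ^ p := by
    refine h.rpow_le p S hL (B := B.filter (· < j)) (by omega) ?_ ?_ ε 3 _ (by omega)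
      (fun n hn => hε n (Finset.mem_of_mem_filter n hn)) ?_
    · intro n; rw [d₁]; split_ifs
      · exact hf n
      · simp
    · intro n hn
      rw [Finset.mem_filter] at hn
      rw [d₁, if_pos hn.2, hB n hn.1]
    · refine Set.disjoint_left.2 fun n hn hs => hs ?_
      simp only [Finset.coe_filter, Set.mem_ofPred_eq] at hn
      rw [d₁, if_neg hn.2]
  have b₂ : ‖S.signedSum ε (A.filter (· < j))‖ ^ p ≤ (3 : ℕ) * (L * ‖f₂‖) ^ p := by
    refine h.rpow_le p S hL (B := B.filter (¬ · < j)) (by omega) ?_ ?_ ε 3 _ (by omega)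
      (fun n hn => hε n (Finset.mem_of_mem_filter n hn)) ?_
    · intro n; rw [d₂]; split_ifs
      · simp
      · exact hf n
    · intro n hn
      rw [Finset.mem_filter] at hn
      rw [d₂, if_neg hn.2, hB n hn.1]
    · refine Set.disjoint_left.2 fun n hn hs => hs ?_
      simp only [Finset.coe_filter, Set.mem_ofPred_eq] at hn
      rw [d₂, if_pos hn.2]
  have e : S.signedSum ε A
      = S.signedSum ε (A.filter (· < j)) + S.signedSum ε (A.filter (¬ · < j)) :=
    (Finset.sum_filter_add_sum_filter_not A _ _).symm
  have c : ∀ g : X, ‖g‖ ≤ K₁ * ‖f‖ → (L * ‖g‖) ^ p ≤ (L * (K₁ * ‖f‖)) ^ p := by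
    intro g hg
    have := hX.norm_nonneg g
    exact Real.rpow_le_rpow (by positivity) (by gcongr) hp.le
  have tot : ‖S.signedSum ε A‖ ^ p ≤ 6 * (L * (K₁ * ‖f‖)) ^ p := by
    rw [e]
    refine (hX.norm_add_rpow_le _ _).trans ?_
    push_cast at b₁ b₂
    linarith [c f₁ n₁, c f₂ n₂]
  have := le_of_rpow_le 𝕜 p (by norm_num) (by positivity) tot
  calc _ ≤ _ := this
    _ = (6 : ℝ) ^ p⁻¹ * K₁ * L * ‖f‖ := by ring
    _ ≤ _ := by gcongr; exact le_max_left _ _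

/-- A polynomial bound for `ν_m` in terms of a domination constant, as an admissible exponent. -/
theorem exists_largestCoeffSymmetry_div_le (b : ℕ → ℝ≥0∞) {K : ℝ} (hK : 1 ≤ K) {R : ℕ}
    (hR : R ≠ 0)
    (h : ∀ m, 1 ≤ m → b m ≠ ⊤ → ∃ L : ℝ, 1 ≤ L ∧ ENNReal.ofReal L ≤ 2 * b m ∧
      DominatesFlat S m (K * L ^ R)) :
    ∃ C : ℝ≥0, ∀ m : ℕ, 1 ≤ m → largestCoeffSymmetry 𝕜 X S m / (b m) ^ (R : ℝ) ≤ C := by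
  have hp := hX.p_pos
  refine ⟨Real.toNNReal ((3 : ℝ) ^ p⁻¹ * K * 2 ^ R), fun m hm => ?_⟩
  -- If b_m is infinite, the quotient is 0.
  rcases eq_or_ne (b m) ⊤ with htop | hfin
  · rw [htop, ENNReal.top_rpow_of_pos (by positivity), ENNReal.div_top]
    exact zero_le
  obtain ⟨L, hL, hLb, hfl⟩ := h m hm hfin
  refine ENNReal.div_le_of_le_mul ?_
  refine (largestCoeffSymmetry_le p S
    (one_le_mul_of_one_le_of_one_le hK (one_le_pow₀ hL)) hfl).trans ?_
  rw [ENNReal.rpow_natCast]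
  calc ENNReal.ofReal ((3 : ℝ) ^ p⁻¹ * (K * L ^ R))
      = ENNReal.ofReal ((3 : ℝ) ^ p⁻¹ * K) * ENNReal.ofReal L ^ R := by
        rw [← ENNReal.ofReal_pow (by linarith), ← ENNReal.ofReal_mul (by positivity), mul_assoc]
    _ ≤ ENNReal.ofReal ((3 : ℝ) ^ p⁻¹ * K) * (2 * b m) ^ R := by gcongr
    _ = ENNReal.ofReal ((3 : ℝ) ^ p⁻¹ * K * 2 ^ R) * b m ^ R := by
        rw [ENNReal.ofReal_mul (by positivity : (0:ℝ) ≤ (3 : ℝ) ^ p⁻¹ * K),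
          ENNReal.ofReal_pow (by norm_num), mul_pow, mul_assoc]
        norm_num

end Upper

/-! ### Admissible exponents and inclusions between their sets. -/

section Exponents

variable (𝕜 : Type) [RCLike 𝕜]

theorem one_mem_exponentsB_squeezeSymmetry :
    1 ∈ exponentsB 𝕜 (largestCoeffSymmetry.{u} 𝕜) (squeezeSymmetry.{u} 𝕜) := by
  intro p X _ _ _ _ _ S
  have := exists_largestCoeffSymmetry_div_le p S (squeezeSymmetry 𝕜 X S) (K := 1) le_rfl
    (R := 1) one_ne_zero fun m hm hfin => by simpa using exists_dominatesFlat p S hm hfin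
  simpa using this

theorem two_mem_exponentsB_disjointSqueezeSymmetry :
    2 ∈ exponentsB 𝕜 (largestCoeffSymmetry.{u} 𝕜) (disjointSqueezeSymmetry.{u} 𝕜) := by
  intro p X _ _ _ _ hX S
  have := exists_largestCoeffSymmetry_div_le p S (disjointSqueezeSymmetry 𝕜 X S)
    (K := (2 : ℝ) ^ p⁻¹)
    (Real.one_le_rpow (by norm_num) (inv_nonneg.2 (hX.p_pos).le))
    (R := 2) two_ne_zero fun m hm hfin => by
      obtain ⟨L, h1, h2, h3⟩ := exists_dominatesDisjoint p S hm hfin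
      exact ⟨L, h1, h2, h3.dominatesFlat p S h1⟩
  simpa using this

theorem one_mem_exponentsS_disjointSqueezeSymmetry :
    1 ∈ exponentsS 𝕜 (largestCoeffSymmetry.{u} 𝕜) (disjointSqueezeSymmetry.{u} 𝕜) := by
  intro p X _ _ _ _ hX S hS
  obtain ⟨K, hK1, hK⟩ := DominatesDisjoint.dominatesFlat_of_isSchauder p S hS
  have := exists_largestCoeffSymmetry_div_le p S (disjointSqueezeSymmetry 𝕜 X S) hK1
    (R := 1) one_ne_zero fun m hm hfin => by
      obtain ⟨L, h1, h2, h3⟩ := exists_dominatesDisjoint p S hm hfin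
      exact ⟨L, h1, h2, by simpa using hK m L h1 h3⟩
  simpa using this

theorem exponentsB_subset_exponentsM (a b : SystemParameter.{u} 𝕜) :
    exponentsB 𝕜 a b ⊆ exponentsM 𝕜 a b := by
  intro R hR p X _ _ _ _ hX S _
  exact hR p X S

theorem exponentsM_subset_exponentsS (a b : SystemParameter.{u} 𝕜) :
    exponentsM 𝕜 a b ⊆ exponentsS 𝕜 a b := by
  intro R hR p X _ _ _ _ hX S hS
  exact hR p X S hS.1

theorem EReal.sInf_image_coe_of_isLeast {U : Set ℝ} {r : ℝ} (h : IsLeast U r) :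
    sInf ((fun R : ℝ => (R : EReal)) '' U) = r := by
  refine le_antisymm (sInf_le ⟨r, h.1, rfl⟩) (le_sInf ?_)
  rintro _ ⟨R, hR, rfl⟩
  exact EReal.coe_le_coe_iff.2 (h.2 hR)

end Exponents

theorem isPBanachSpace_one (𝕜 : Type*) [RCLike 𝕜] (X : Type*) [NormedAddCommGroup X]
    [NormedSpace 𝕜 X] [CompleteSpace X] : IsPBanachSpace 𝕜 1 X where
  p_pos := one_pos
  p_le_one := le_rfl
  norm_nonneg := norm_nonneg
  norm_eq_zero_iff _ := norm_eq_zero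
  norm_smul := norm_smul
  norm_add_rpow_le f g := by simpa using norm_add_le f g
  uniformity_hasBasis := by
    simpa [dist_eq_norm] using Metric.uniformity_basis_dist (α := X)
  complete := inferInstance

/-! ### Bounding the squeeze parameters from above. -/

section LowerBounds

open FundamentalMinimalSystem

variable {𝕜 : Type} [RCLike 𝕜] {X : Type u} [NormedAddCommGroup X] [NormedSpace 𝕜 X]
  (S : FundamentalMinimalSystem 𝕜 X)

/-- By homogeneity f may be divided by its smallest coefficient on B, which keeps the support. -/
theorem norm_signedSum_le_of_normalized {L : ℝ} (hL : 0 ≤ L) (f : X)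
    (A B : Finset ℕ) (hB : B.Nonempty) (ε : ℕ → 𝕜)
    (h : ∀ g : X, S.supp g = S.supp f → (∀ n ∈ B, 1 ≤ ‖S.dual n g‖) →
      ‖S.signedSum ε A‖ ≤ L * ‖g‖) :
    ENNReal.ofReal (B.inf' hB (fun n => ‖S.dual n f‖) * ‖S.signedSum ε A‖) ≤
      ENNReal.ofReal L * ENNReal.ofReal ‖f‖ := by
  set t := B.inf' hB (fun n => ‖S.dual n f‖) with ht
  rw [← ENNReal.ofReal_mul hL]
  refine ENNReal.ofReal_le_ofReal ?_
  have ht0 : 0 ≤ t := by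
    rw [ht]; exact (Finset.le_inf'_iff _ _).2 fun n _ => norm_nonneg _
  rcases ht0.eq_or_lt with h0 | hpos
  · rw [← h0, zero_mul]; positivity
  have := h ((t : 𝕜)⁻¹ • f) (by ext n; simp [supp, hpos.ne']) (by
    intro n hn
    rw [map_smul, norm_smul, norm_inv, RCLike.norm_ofReal, abs_of_pos hpos, ← div_eq_inv_mul,
      one_le_div hpos]
    exact Finset.inf'_le _ hn)
  rw [norm_smul, norm_inv, RCLike.norm_ofReal, abs_of_pos hpos] at this
  calc t * ‖S.signedSum ε A‖ ≤ t * (L * (t⁻¹ * ‖f‖)) := by gcongr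
    _ = L * ‖f‖ := by field_simp

theorem squeezeSymmetry_le {m : ℕ} {L : ℝ} (hL : 0 ≤ L)
    (h : ∀ (f : X) (A B : Finset ℕ) (ε : ℕ → 𝕜), B.Nonempty → A.card = B.card → B.card ≤ m →
      IsSignOn ε A → (∀ n ∈ B, 1 ≤ ‖S.dual n f‖) → ‖S.signedSum ε A‖ ≤ L * ‖f‖) :
    squeezeSymmetry 𝕜 X S m ≤ ENNReal.ofReal L :=
  sInf_le fun f A B hB ε hAB hBm _ hε =>
    norm_signedSum_le_of_normalized S hL f A B hB ε
      fun g _ hg => h g A B ε hB hAB hBm hε hg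

theorem disjointSqueezeSymmetry_le {m : ℕ} {L : ℝ} (hL : 0 ≤ L)
    (h : ∀ (f : X) (A B : Finset ℕ) (ε : ℕ → 𝕜), B.Nonempty → A.card = B.card → B.card ≤ m →
      IsSignOn ε A → (∀ n ∈ B, 1 ≤ ‖S.dual n f‖) → (∀ n ∈ A, S.dual n f = 0) →
      ‖S.signedSum ε A‖ ≤ L * ‖f‖) :
    disjointSqueezeSymmetry 𝕜 X S m ≤ ENNReal.ofReal L :=
  sInf_le fun f A B hB ε hAB hBm _ hε hd =>
    norm_signedSum_le_of_normalized S hL f A B hB ε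
      fun g hg1 hg => h g A B ε hB hAB hBm hε hg fun n hn => by
        by_contra hne
        exact Set.disjoint_left.1 hd hn (hg1 ▸ hne)

/-- If `a_m / b_m ^ R` is bounded, so is `s / w ^ (max R 0)` for lower bounds `s` of `a_m` and upper
bounds `w` of `b_m`. -/
theorem le_mul_rpow_of_div_rpow_le {a b : ℝ≥0∞} {R s w : ℝ} {C : ℝ≥0}
    (h : a / b ^ R ≤ C) (hb1 : 1 ≤ b) (hs : ENNReal.ofReal s ≤ a)
    (hb : b ≤ ENNReal.ofReal w) : s ≤ C * w ^ (max R 0) := by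
  have hbt : b ≠ ⊤ := ne_top_of_le_ne_top ENNReal.ofReal_ne_top hb
  have hw : 1 ≤ w := by
    have := hb1.trans hb
    simpa using this
  -- Since b ≥ 1, raising the exponent only decreases the quotient; a nonnegative exponent is needed
  -- to pass from b to its upper bound w.
  have hR : a / b ^ (max R 0) ≤ C :=
    (ENNReal.div_le_div_left (ENNReal.rpow_le_rpow_of_exponent_le hb1 (le_max_left _ _)) _).trans h
  have h1 : a ≤ C * b ^ (max R 0) := by
    refine (ENNReal.div_le_iff ?_ ?_).1 hR
    · exact (ENNReal.rpow_pos (by positivity) hbt).ne'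
    · exact ENNReal.rpow_ne_top_of_nonneg (le_max_right _ _) hbt
  have h2 : ENNReal.ofReal s ≤ ENNReal.ofReal (C * w ^ (max R 0)) := by
    refine hs.trans (h1.trans ?_)
    rw [ENNReal.ofReal_mul (p := (C : ℝ)) C.2,
      ← ENNReal.ofReal_rpow_of_nonneg (by linarith) (le_max_right _ _),
      ENNReal.ofReal_coe_nnreal]
    gcongr
  exact (ENNReal.ofReal_le_ofReal_iff (by positivity)).1 h2

end LowerBounds

/-! ### Systems in ℓ₂-sums of finite-dimensional blocks. -/

section Blocks

open FundamentalMinimalSystem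

variable {𝕜 : Type} [RCLike 𝕜] {α : Type u} {E : α → Type} [∀ k, NormedAddCommGroup (E k)]
  [∀ k, NormedSpace 𝕜 (E k)] {J : α → Type} [∀ k, Fintype (J k)]

open Classical in
/-- The system of an `ℓ₂`-sum of finite-dimensional spaces that is built from bases of the
summands. -/
noncomputable def blockSystem (b : ∀ k, Module.Basis (J k) 𝕜 (E k)) (e : ℕ ≃ Σ k, J k) {V D : ℝ}
    (hV : ∀ k j, ‖b k j‖ ≤ V) (hD : ∀ k j v, ‖(b k).repr v j‖ ≤ D * ‖v‖) :
    FundamentalMinimalSystem 𝕜 (lp E 2) where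
  vec n := lp.single 2 (e n).1 (b (e n).1 (e n).2)
  dual n := LinearMap.mkContinuous ((b (e n).1).coord (e n).2 ∘ₗ lp.evalₗ E 2 (e n).1) (max D 0)
    fun f => (hD _ _ _).trans (mul_le_mul (le_max_left _ _)
      (lp.norm_apply_le_norm two_ne_zero f _) (norm_nonneg _) (le_max_right _ _))
  biorthogonal i j := by
    change (b (e i).1).repr (lp.single (E := E) 2 (e j).1 (b (e j).1 (e j).2) (e i).1) (e i).2 = _
    by_cases h : i = j
    · subst h; simp
    rw [if_neg h]
    by_cases h1 : (e i).1 = (e j).1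
    · rcases hi : e i with ⟨k, x⟩
      rcases hj : e j with ⟨l, y⟩
      rw [hi, hj] at h1
      obtain rfl : k = l := h1
      have hxy : y ≠ x := fun hxy => h (e.injective (by rw [hi, hj, hxy]))
      rw [lp.single_apply_self, Module.Basis.repr_self, Finsupp.single_eq_of_ne hxy.symm]
    · rw [lp.single_apply_ne 2 _ _ h1]; simp
  dense_span := by
    intro f
    have hs := lp.hasSum_single (E := E) (p := 2) (by simp) f
    refine mem_closure_of_tendsto hs (Filter.Eventually.of_forall fun F => ?_)
    refine Submodule.sum_mem _ fun k _ => ?_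
    rw [← (b k).sum_repr (f k)]
    change lp.lsingle (𝕜 := 𝕜) (E := E) 2 k _ ∈ _
    rw [map_sum]
    refine Submodule.sum_mem _ fun j _ => ?_
    rw [map_smul]
    refine Submodule.smul_mem _ _ (Submodule.subset_span ⟨e.symm ⟨k, j⟩, ?_⟩)
    change lp.single (E := E) 2 (e (e.symm ⟨k, j⟩)).1 (b _ (e (e.symm ⟨k, j⟩)).2) = _
    rw [Equiv.apply_symm_apply]
    rfl
  vec_bounded := ⟨V, fun n => by rw [lp.norm_single (by simp)]; exact hV _ _⟩
  dual_bounded := ⟨max D 0, fun n f => (hD _ _ _).trans (mul_le_mul (le_max_left _ _)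
      (lp.norm_apply_le_norm two_ne_zero f _) (norm_nonneg _) (le_max_right _ _))⟩

variable (b : ∀ k, Module.Basis (J k) 𝕜 (E k)) (e : ℕ ≃ Σ k, J k) {V D : ℝ}
    (hV : ∀ k j, ‖b k j‖ ≤ V) (hD : ∀ k j v, ‖(b k).repr v j‖ ≤ D * ‖v‖)

theorem blockSystem_dual (n : ℕ) (f : lp E 2) :
    (blockSystem b e hV hD).dual n f = (b (e n).1).repr (f (e n).1) (e n).2 := rfl

theorem blockSystem_vec [DecidableEq α] (n : ℕ) :
    (blockSystem b e hV hD).vec n = lp.single 2 (e n).1 (b (e n).1 (e n).2) := by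
  obtain rfl := Subsingleton.elim ‹DecidableEq α› (Classical.typeDecidableEq α)
  rfl

/-- Every f is the norm limit of its restrictions to finitely many blocks, so φ is the weak-star
limit of its own restrictions, which are finite combinations of the dual system. -/
theorem blockSystem_isMarkushevich : (blockSystem b e hV hD).IsMarkushevich := by
  classical
  intro φ
  have ht : Filter.Tendsto (fun F : Finset α => ∑ k ∈ F, ∑ j, φ (lp.single 2 k (b k j)) •
      StrongDual.toWeakDual ((blockSystem b e hV hD).dual (e.symm ⟨k, j⟩))) Filter.atTop
      (nhds φ) := by
    rw [tendsto_iff_forall_eval_tendsto_topDualPairing]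
    intro f
    have hs : HasSum (fun k => φ (lp.single 2 k (f k))) (φ f) :=
      (lp.hasSum_single (E := E) (p := 2) (by simp) f).map φ (map_continuous φ)
    refine hs.congr fun F => ?_
    let ev : WeakDual 𝕜 (lp E 2) →ₗ[𝕜] 𝕜 :=
      { toFun := fun ψ => ψ f, map_add' := fun _ _ => rfl, map_smul' := fun _ _ => rfl }
    change _ = ev _
    refine Eq.trans ?_ (map_sum ev _ _).symm
    refine Finset.sum_congr rfl fun k _ => ?_
    refine Eq.trans ?_ (map_sum ev _ _).symm
    have h1 : lp.single 2 k (f k)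
        = ∑ j, (b k).repr (f k) j • (lp.single 2 k (b k j) : lp E 2) := by
      conv_lhs => rw [← (b k).sum_repr (f k)]
      change lp.lsingle (𝕜 := 𝕜) (E := E) 2 k _ = _
      rw [map_sum]
      refine Finset.sum_congr rfl fun j _ => ?_
      rw [map_smul]; rfl
    refine (congrArg φ h1).trans ((map_sum φ _ _).trans ?_)
    refine Finset.sum_congr rfl fun j _ => ?_
    have h2 : (blockSystem b e hV hD).dual (e.symm ⟨k, j⟩) f = (b k).repr (f k) j := by
      rw [blockSystem_dual, e.apply_symm_apply]
    refine Eq.trans ?_ (map_smul ev _ _).symm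
    change _ = _ • (blockSystem b e hV hD).dual (e.symm ⟨k, j⟩) f
    rw [h2, map_smul, smul_eq_mul, smul_eq_mul, mul_comm]
  refine mem_closure_of_tendsto ht (Filter.Eventually.of_forall fun F => ?_)
  refine Submodule.sum_mem _ fun k _ => Submodule.sum_mem _ fun j _ => ?_
  exact Submodule.smul_mem _ _ (Submodule.subset_span ⟨_, rfl⟩)

end Blocks

/-! ### Counting positions block by block. -/

section BlockPart

variable {α : Type u} {J : α → Type} [∀ k, Fintype (J k)] (e : ℕ ≃ Σ k, J k)

open Classical in
/-- The part of `B` that lies in the block `k`. -/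
noncomputable def blockPart (B : Finset ℕ) (k : α) : Finset (J k) :=
  Finset.univ.filter fun j => e.symm ⟨k, j⟩ ∈ B

theorem mem_blockPart {B : Finset ℕ} {k : α} {j : J k} :
    j ∈ blockPart e B k ↔ e.symm ⟨k, j⟩ ∈ B := by simp [blockPart]

theorem card_blockPart (B : Finset ℕ) (k : α) [DecidablePred fun n => (e n).1 = k] :
    (blockPart e B k).card = (B.filter fun n => (e n).1 = k).card := by
  refine Finset.card_bij (fun j _ => e.symm ⟨k, j⟩) ?_ ?_ ?_
  · intro j hj
    simpa using (mem_blockPart e).1 hj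
  · intro j _ j' _ h
    simpa using h
  · intro n hn
    obtain ⟨hn, rfl⟩ := Finset.mem_filter.1 hn
    exact ⟨(e n).2, (mem_blockPart e).2 (by simpa using hn), by simp⟩

open Classical in
theorem card_eq_sum_blockPart (B : Finset ℕ) :
    B.card = ∑ k ∈ B.image (fun n => (e n).1), (blockPart e B k).card := by
  rw [Finset.card_eq_sum_card_image (fun n => (e n).1) B]
  exact Finset.sum_congr rfl fun k _ => (card_blockPart e B k).symm

theorem card_le_of_blockPart_le {E : α → Type} [∀ k, NormedAddCommGroup (E k)] {f : lp E 2}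
    {B : Finset ℕ} {c : ℝ} (hc : 0 ≤ c)
    (h : ∀ k, (blockPart e B k).Nonempty → ((blockPart e B k).card : ℝ) ≤ c * ‖f k‖ ^ 2) :
    (B.card : ℝ) ≤ c * ‖f‖ ^ 2 := by
  classical
  rw [card_eq_sum_blockPart e B]
  push_cast
  have h2 := lp.sum_rpow_le_norm_rpow (by norm_num) f (B.image fun n => (e n).1)
  norm_num at h2
  calc _ ≤ ∑ k ∈ B.image (fun n => (e n).1), c * ‖f k‖ ^ 2 := by
        refine Finset.sum_le_sum fun k _ => ?_
        rcases (blockPart e B k).eq_empty_or_nonempty with h0 | h0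
        · rw [h0]; simp; positivity
        · exact h k h0
    _ ≤ _ := by rw [← Finset.mul_sum]; gcongr

end BlockPart

theorem le_largestCoeffSymmetry {𝕜 : Type} [RCLike 𝕜] {X : Type u} [NormedAddCommGroup X]
    [NormedSpace 𝕜 X] (S : FundamentalMinimalSystem 𝕜 X) {m : ℕ} (f : X) (A B : Finset ℕ)
    (ε δ : ℕ → 𝕜) (hAB : A.card = B.card) (hB : B.card ≤ m) (hε : IsSignOn ε A)
    (hδ : IsSignOn δ B) (hf : ∀ n, ‖S.dual n f‖ ≤ 1)
    (hd : Disjoint (S.supp f) ((A ∪ B : Finset ℕ) : Set ℕ)) {s : ℝ} (hs : 0 ≤ s)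
    (h : s * ‖S.signedSum δ B + f‖ ≤ ‖S.signedSum ε A + f‖)
    (h0 : S.signedSum δ B + f ≠ 0) :
    ENNReal.ofReal s ≤ largestCoeffSymmetry 𝕜 X S m := by
  refine le_trans ?_ (le_sSup ⟨f, A, B, ε, δ, hAB, hB, hε, hδ, hf, hd, rfl⟩)
  rw [ENNReal.le_div_iff_mul_le (by simp [h0]) (by simp), ← ENNReal.ofReal_mul hs]
  exact ENNReal.ofReal_le_ofReal h

/-! ### Exponent 1 is necessary: the ℓ₂-sum of the spaces ℓ₁^{k+1}. -/

section L1Blocks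

open FundamentalMinimalSystem

variable (𝕜 : Type) [RCLike 𝕜]

/-- The blocks `ℓ₁^{k+1}`. -/
abbrev L1Block (k : ULift.{u} ℕ) : Type := PiLp 1 fun _ : Fin (k.down + 1) => 𝕜

/-- The unit vector basis of `ℓ₁^{k+1}`. -/
noncomputable def l1BlockBasis (k : ULift.{u} ℕ) :
    Module.Basis (Fin (k.down + 1)) 𝕜 (L1Block 𝕜 k) :=
  PiLp.basisFun 1 𝕜 (Fin (k.down + 1))

theorem l1Block_norm (k : ULift.{u} ℕ) (v : L1Block 𝕜 k) :
    ‖v‖ = ∑ j, ‖(l1BlockBasis 𝕜 k).repr v j‖ := by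
  rw [PiLp.norm_eq_of_L1]; rfl

theorem norm_l1BlockBasis (k : ULift.{u} ℕ) (j : Fin (k.down + 1)) :
    ‖l1BlockBasis 𝕜 k j‖ = 1 := by
  rw [l1Block_norm]
  simp [Finsupp.single_apply, apply_ite norm]

theorem norm_l1BlockBasis_repr_le (k : ULift.{u} ℕ) (j : Fin (k.down + 1)) (v : L1Block 𝕜 k) :
    ‖(l1BlockBasis 𝕜 k).repr v j‖ ≤ 1 * ‖v‖ := by
  rw [l1Block_norm, one_mul]
  exact Finset.single_le_sum (f := fun j => ‖(l1BlockBasis 𝕜 k).repr v j‖)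
    (fun _ _ => norm_nonneg _) (Finset.mem_univ j)

variable (e : ℕ ≃ Σ k : ULift.{u} ℕ, Fin (k.down + 1))

/-- The unit vector system of the `ℓ₂`-sum of the spaces `ℓ₁^{k+1}`. -/
noncomputable def l1System : FundamentalMinimalSystem 𝕜 (lp (L1Block.{u} 𝕜) 2) :=
  blockSystem (l1BlockBasis 𝕜) e (fun k j => (norm_l1BlockBasis 𝕜 k j).le)
    (norm_l1BlockBasis_repr_le 𝕜)

theorem l1System_repr (f : lp (L1Block.{u} 𝕜) 2) (k : ULift.{u} ℕ) (j : Fin (k.down + 1)) :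
    (l1BlockBasis 𝕜 k).repr (f k) j = (l1System 𝕜 e).dual (e.symm ⟨k, j⟩) f := by
  rw [l1System, blockSystem_dual, e.apply_symm_apply]

theorem norm_l1System_vec (n : ℕ) : ‖(l1System 𝕜 e).vec n‖ = 1 := by
  rw [l1System, blockSystem_vec, lp.norm_single (by simp), norm_l1BlockBasis]

/-- Coordinate projections do not increase the ℓ₁ norm of any block, so the enumeration e of the
positions is irrelevant. -/
theorem l1System_isSchauder : (l1System 𝕜 e).IsSchauder := by
  refine ⟨blockSystem_isMarkushevich _ _ _ _, 1, fun m f => ?_⟩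
  rw [one_mul]
  refine lp.norm_mono two_ne_zero fun k => ?_
  rw [l1Block_norm, l1Block_norm]
  refine Finset.sum_le_sum fun j _ => ?_
  rw [l1System_repr 𝕜 e, l1System_repr 𝕜 e, dual_proj]
  split_ifs <;> simp

theorem squeezeSymmetry_l1System_le (m : ℕ) :
    squeezeSymmetry 𝕜 _ (l1System 𝕜 e) m ≤ ENNReal.ofReal (√m) := by
  refine squeezeSymmetry_le _ (Real.sqrt_nonneg _) ?_
  intro f A B ε _ hAB hBm hε hf
  have h1 : ‖(l1System 𝕜 e).signedSum ε A‖ ≤ A.card := by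
    refine (norm_sum_le _ _).trans ?_
    calc _ ≤ ∑ _n ∈ A, (1 : ℝ) := Finset.sum_le_sum fun n hn => by
          rw [norm_smul, hε n hn, norm_l1System_vec, one_mul]
      _ = _ := by simp
  have h2 : (B.card : ℝ) ≤ 1 * ‖f‖ ^ 2 := by
    refine card_le_of_blockPart_le e zero_le_one fun k hk => ?_
    have : ((blockPart e B k).card : ℝ) ≤ ‖f k‖ := by
      rw [l1Block_norm]
      calc _ = ∑ _j ∈ blockPart e B k, (1 : ℝ) := by simp
        _ ≤ ∑ j ∈ blockPart e B k, ‖(l1BlockBasis 𝕜 k).repr (f k) j‖ :=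
          Finset.sum_le_sum fun j hj => by
            rw [l1System_repr 𝕜 e]; exact hf _ ((mem_blockPart e).1 hj)
        _ ≤ _ := Finset.sum_le_sum_of_subset_of_nonneg (Finset.subset_univ _)
          fun _ _ _ => norm_nonneg _
    -- A nonempty part has n ≥ 1 elements, so n ≤ n² ≤ ‖f k‖².
    have h1 : (1 : ℝ) ≤ (blockPart e B k).card := by exact_mod_cast hk.card_pos
    nlinarith
  have h3 : √(B.card : ℝ) ≤ ‖f‖ := Real.sqrt_le_iff.2 ⟨norm_nonneg _, by linarith⟩
  calc _ ≤ (A.card : ℝ) := h1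
    _ = √(B.card : ℝ) * √(B.card : ℝ) := by rw [hAB, Real.mul_self_sqrt (by positivity)]
    _ ≤ √m * ‖f‖ := by gcongr

theorem le_largestCoeffSymmetry_l1System (k : ℕ) :
    ENNReal.ofReal (√((k + 1 : ℕ) : ℝ)) ≤
      largestCoeffSymmetry 𝕜 _ (l1System 𝕜 e) (k + 1) := by
  classical
  set S := l1System 𝕜 e with hS
  -- A is the whole block k, and B below takes one position from each of the blocks 0, …, k.
  set A : Finset ℕ := Finset.univ.image fun j : Fin (k + 1) => e.symm ⟨⟨k⟩, j⟩ with hA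
  have hinj : Function.Injective fun l : Fin (k + 1) =>
      e.symm ⟨⟨l⟩, (0 : Fin ((l : ℕ) + 1))⟩ := by
    intro l l' h
    have := congrArg Sigma.fst (e.symm.injective h)
    simpa [Fin.ext_iff] using this
  set B : Finset ℕ := Finset.univ.image fun l : Fin (k + 1) =>
      e.symm ⟨⟨l⟩, (0 : Fin ((l : ℕ) + 1))⟩ with hB
  have hAc : A.card = k + 1 := by
    rw [hA, Finset.card_image_of_injective, Finset.card_univ, Fintype.card_fin]
    intro j j' h
    simpa using h
  have hBc : B.card = k + 1 := by
    rw [hB, Finset.card_image_of_injective _ hinj, Finset.card_univ, Fintype.card_fin]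
  have hAn : ((k + 1 : ℕ) : ℝ) ≤ ‖S.signedSum (fun _ => 1) A‖ := by
    refine le_trans ?_ (lp.norm_apply_le_norm two_ne_zero _ ⟨k⟩)
    rw [l1Block_norm]
    refine le_of_eq ?_
    calc ((k + 1 : ℕ) : ℝ) = ∑ _j : Fin (k + 1), (1 : ℝ) := by simp
      _ = _ := Finset.sum_congr rfl fun j _ => by
        rw [l1System_repr 𝕜 e, ← hS, dual_signedSum, if_pos, norm_one]
        rw [hA]; exact Finset.mem_image_of_mem _ (Finset.mem_univ j)
  have hBn : ‖S.signedSum (fun _ => 1) B‖ ≤ √((k + 1 : ℕ) : ℝ) := by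
    refine Real.le_sqrt_of_sq_le ?_
    have hsum : S.signedSum (fun _ => 1) B
        = ∑ l ∈ Finset.univ.image (fun l : Fin (k + 1) => (⟨l⟩ : ULift.{u} ℕ)),
          lp.single 2 l (l1BlockBasis 𝕜 l 0) := by
      rw [signedSum, hB, Finset.sum_image fun _ _ _ _ h => hinj h, Finset.sum_image]
      · refine Finset.sum_congr rfl fun l _ => ?_
        rw [one_smul, hS, l1System, blockSystem_vec, e.apply_symm_apply]
      · intro l _ l' _ h
        simpa [Fin.ext_iff] using h
    have := lp.norm_sum_single (E := L1Block.{u} 𝕜) (p := 2) (by norm_num)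
      (fun l => l1BlockBasis 𝕜 l 0)
      (Finset.univ.image (fun l : Fin (k + 1) => (⟨l⟩ : ULift.{u} ℕ)))
    rw [← hsum] at this
    norm_num [norm_l1BlockBasis] at this
    rw [this, Finset.card_image_of_injective]
    · simp
    · intro l l' h
      simpa [Fin.ext_iff] using h
  refine le_largestCoeffSymmetry S 0 A B (fun _ => 1) (fun _ => 1) (by omega) hBc.le
    (fun n _ => norm_one) (fun n _ => norm_one) (by simp) (by simp [supp]) (Real.sqrt_nonneg _)
    ?_ ?_
  · rw [add_zero, add_zero]
    refine le_trans ?_ hAn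
    calc _ ≤ √((k + 1 : ℕ) : ℝ) * √((k + 1 : ℕ) : ℝ) := by gcongr
      _ = _ := Real.mul_self_sqrt (by positivity)
  · rw [add_zero]
    intro h0
    have h1 := S.dual_signedSum (fun _ => 1) B (e.symm ⟨⟨0⟩, (0 : Fin 1)⟩)
    rw [h0, map_zero, if_pos] at h1
    · exact zero_ne_one h1
    · rw [hB]
      exact Finset.mem_image.2 ⟨0, Finset.mem_univ _, rfl⟩

theorem exists_equiv_sigma {J : ULift.{u} ℕ → Type} [∀ k, Fintype (J k)] [∀ k, Nonempty (J k)] :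
    Nonempty (ℕ ≃ Σ k, J k) := by
  have : Infinite (Σ k, J k) :=
    Infinite.of_injective (fun n : ℕ => (⟨⟨n⟩, Classical.arbitrary _⟩ : Σ k, J k)) (by
      intro a b h
      have := congrArg Sigma.fst h
      simpa using this)
  obtain ⟨d⟩ := nonempty_denumerable (Σ k, J k)
  exact ⟨(Denumerable.eqv _).symm⟩

theorem one_le_of_mem_exponentsS (b : SystemParameter.{u} 𝕜)
    (hb : ∀ (X : Type u) [NormedAddCommGroup X] [NormedSpace 𝕜 X] [CompleteSpace X]
      (S : FundamentalMinimalSystem 𝕜 X) (m : ℕ), 1 ≤ m → 1 ≤ b X S m ∧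
      b X S m ≤ squeezeSymmetry 𝕜 X S m) {R : ℝ}
    (hR : R ∈ exponentsS 𝕜 (largestCoeffSymmetry.{u} 𝕜) b) : 1 ≤ R := by
  obtain ⟨e⟩ := exists_equiv_sigma.{u} (J := fun k => Fin (k.down + 1))
  have : IsPBanachSpace 𝕜 1 (lp (L1Block.{u} 𝕜) 2) := isPBanachSpace_one 𝕜 _
  obtain ⟨C, hC⟩ := hR 1 _ (l1System 𝕜 e) (l1System_isSchauder 𝕜 e)
  by_contra hlt
  rw [not_le] at hlt
  set R' := max R 0 with hR'
  have hR1 : R' < 1 := max_lt hlt one_pos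
  have key : ∀ k : ℕ, √((k + 1 : ℕ) : ℝ) ^ (1 - R') ≤ C := by
    intro k
    have h1 := hb _ (l1System 𝕜 e) (k + 1) (by omega)
    have h2 := le_mul_rpow_of_div_rpow_le (hC (k + 1) (by omega)) h1.1
      (le_largestCoeffSymmetry_l1System 𝕜 e k)
      (h1.2.trans (squeezeSymmetry_l1System_le 𝕜 e (k + 1)))
    have hpos : 0 < √((k + 1 : ℕ) : ℝ) := by positivity
    rw [Real.rpow_sub hpos, Real.rpow_one, div_le_iff₀ (by positivity)]
    exact h2
  have ht : Filter.Tendsto (fun k : ℕ => √((k + 1 : ℕ) : ℝ) ^ (1 - R')) Filter.atTop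
      Filter.atTop := by
    refine (tendsto_rpow_atTop (by linarith)).comp (Real.tendsto_sqrt_atTop.comp ?_)
    exact tendsto_natCast_atTop_atTop.comp (Filter.tendsto_add_atTop_nat 1)
  obtain ⟨k, hk⟩ := (ht.eventually_gt_atTop (C : ℝ)).exists
  exact absurd (key k) (not_le.2 hk)

end L1Blocks

/-! ### A rank-two distortion of a Hilbert space. -/

section Stretch

variable {𝕜 : Type} [RCLike 𝕜] {F : Type} [NormedAddCommGroup F] [InnerProductSpace 𝕜 F]

/-- The map that multiplies `u` by `α`, multiplies `v` by `α⁻¹` and is the identity on the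
orthogonal complement of `u` and `v`, for orthonormal `u` and `v`. -/
noncomputable def stretch (u v : F) (α : ℝ) : F →ₗ[𝕜] F :=
  LinearMap.id + ((α : 𝕜) - 1) • (innerₛₗ 𝕜 u).smulRight u
    + ((α⁻¹ : ℝ) - 1 : 𝕜) • (innerₛₗ 𝕜 v).smulRight v

variable {u v : F} (hu : ‖u‖ = 1) (hv : ‖v‖ = 1) (huv : inner 𝕜 u v = 0) {α : ℝ}

theorem stretch_apply (x : F) : stretch (𝕜 := 𝕜) u v α x
    = x + ((α : 𝕜) - 1) • inner 𝕜 u x • u + ((α⁻¹ : ℝ) - 1 : 𝕜) • inner 𝕜 v x • v := rfl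

include hu hv huv

omit hv in
theorem inner_left_stretch (x : F) :
    inner 𝕜 u (stretch (𝕜 := 𝕜) u v α x) = α * inner 𝕜 u x := by
  rw [stretch_apply, inner_add_right, inner_add_right, inner_smul_right, inner_smul_right,
    inner_smul_right, inner_smul_right, huv, inner_self_eq_norm_sq_to_K, hu]
  push_cast; ring

omit hu in
theorem inner_right_stretch (x : F) :
    inner 𝕜 v (stretch (𝕜 := 𝕜) u v α x) = (α⁻¹ : ℝ) * inner 𝕜 v x := by
  rw [stretch_apply, inner_add_right, inner_add_right, inner_smul_right, inner_smul_right,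
    inner_smul_right, inner_smul_right, inner_eq_zero_symm.1 huv, inner_self_eq_norm_sq_to_K, hv]
  push_cast; ring

theorem stretch_inv_stretch (hα : α ≠ 0) (x : F) :
    stretch (𝕜 := 𝕜) u v α⁻¹ (stretch (𝕜 := 𝕜) u v α x) = x := by
  rw [stretch_apply (α := α⁻¹), inner_left_stretch hu huv, inner_right_stretch hv huv,
    stretch_apply]
  have h : (α : 𝕜) ≠ 0 := by exact_mod_cast hα
  rw [inv_inv]
  push_cast
  have e1 : ((α : 𝕜)⁻¹ - 1) * (α * inner 𝕜 u x) = -(((α : 𝕜) - 1) * inner 𝕜 u x) := by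
    field_simp; ring
  have e2 : ((α : 𝕜) - 1) * ((α : 𝕜)⁻¹ * inner 𝕜 v x)
      = -(((α : 𝕜)⁻¹ - 1) * inner 𝕜 v x) := by
    field_simp; ring
  simp only [smul_smul]
  rw [e1, e2, neg_smul, neg_smul]
  abel

/-- `stretch` as a linear equivalence. -/
noncomputable def stretchEquiv (hα : α ≠ 0) : F ≃ₗ[𝕜] F :=
  LinearEquiv.ofLinearMap (stretch u v α) (stretch u v α⁻¹)
    (by
      ext x
      have := stretch_inv_stretch hu hv huv (inv_ne_zero hα) x
      rwa [inv_inv] at this)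
    (by ext x; exact stretch_inv_stretch hu hv huv hα x)

omit huv in
theorem norm_stretch_sub_le (hα : 0 < α) (hα1 : α ≤ 1) (x : F) :
    ‖stretch (𝕜 := 𝕜) u v α x - x‖ ≤ ‖inner 𝕜 u x‖ + α⁻¹ * ‖inner 𝕜 v x‖ := by
  have e : stretch (𝕜 := 𝕜) u v α x - x
      = ((α - 1 : ℝ) : 𝕜) • inner 𝕜 u x • u + ((α⁻¹ - 1 : ℝ) : 𝕜) • inner 𝕜 v x • v := by
    rw [stretch_apply]; push_cast; abel
  have h1 : 1 ≤ α⁻¹ := (one_le_inv₀ hα).2 hα1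
  rw [e]
  refine (norm_add_le _ _).trans ?_
  rw [norm_smul, norm_smul, norm_smul, norm_smul, hu, hv, RCLike.norm_ofReal, RCLike.norm_ofReal,
    mul_one, mul_one, abs_of_nonpos (by linarith), abs_of_nonneg (by linarith)]
  gcongr
  · exact mul_le_of_le_one_left (norm_nonneg _) (by linarith)
  · linarith

omit huv in
theorem norm_stretch_inv_sub_le (hα : 0 < α) (hα1 : α ≤ 1) (x : F) {ψ : F →ₗ[𝕜] 𝕜} {r : ℝ}
    (hψu : ‖ψ u‖ ≤ r) (hψv : ‖ψ v‖ ≤ r) :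
    ‖ψ (stretch (𝕜 := 𝕜) u v α⁻¹ x)‖ ≤ ‖ψ x‖ + (α⁻¹ * r + r) * ‖x‖ := by
  have e : ψ (stretch (𝕜 := 𝕜) u v α⁻¹ x)
      = ψ x + (((α⁻¹ - 1 : ℝ) : 𝕜) * (inner 𝕜 u x * ψ u)
        + ((α - 1 : ℝ) : 𝕜) * (inner 𝕜 v x * ψ v)) := by
    rw [stretch_apply]
    simp only [map_add, map_smul, smul_eq_mul, inv_inv]
    push_cast; ring
  have h1 : 1 ≤ α⁻¹ := (one_le_inv₀ hα).2 hα1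
  have hiu : ‖inner 𝕜 u x‖ ≤ ‖x‖ := by simpa [hu] using norm_inner_le_norm (𝕜 := 𝕜) u x
  have hiv : ‖inner 𝕜 v x‖ ≤ ‖x‖ := by simpa [hv] using norm_inner_le_norm (𝕜 := 𝕜) v x
  rw [e]
  refine (norm_add_le _ _).trans (add_le_add le_rfl ((norm_add_le _ _).trans ?_))
  rw [norm_mul, norm_mul, norm_mul, norm_mul, RCLike.norm_ofReal, RCLike.norm_ofReal,
    abs_of_nonneg (by linarith : 0 ≤ α⁻¹ - 1), abs_of_nonpos (by linarith : α - 1 ≤ 0), add_mul]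
  have a1 : (α⁻¹ - 1) * (‖inner 𝕜 u x‖ * ‖ψ u‖) ≤ α⁻¹ * (‖x‖ * r) := by
    have := (norm_nonneg _).trans hψu
    gcongr; linarith
  have a2 : -(α - 1) * (‖inner 𝕜 v x‖ * ‖ψ v‖) ≤ 1 * (‖x‖ * r) := by
    have := (norm_nonneg _).trans hψu
    gcongr; linarith
  linarith

omit hv in
theorem norm_inner_left_le_norm_stretch (hα : 0 < α) (x : F) :
    α * ‖inner 𝕜 u x‖ ≤ ‖stretch (𝕜 := 𝕜) u v α x‖ := by
  have h := norm_inner_le_norm (𝕜 := 𝕜) u (stretch (𝕜 := 𝕜) u v α x)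
  rwa [inner_left_stretch hu huv, hu, one_mul, norm_mul, RCLike.norm_ofReal,
    abs_of_pos hα] at h

/-- The only direction that the map contracts is u, so the component orthogonal to u is controlled
by the image with a constant independent of α. -/
theorem norm_sub_inner_smul_le_norm_stretch (hα : 0 < α) (hα1 : α ≤ 1) (x : F) :
    ‖x - inner 𝕜 u x • u‖ ≤ 3 * ‖stretch (𝕜 := 𝕜) u v α x‖ := by
  set y := stretch (𝕜 := 𝕜) u v α x with hy
  have h1 : 1 ≤ α⁻¹ := (one_le_inv₀ hα).2 hα1
  have e : x - inner 𝕜 u x • u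
      = y - inner 𝕜 u y • u - ((α⁻¹ - 1 : ℝ) : 𝕜) • inner 𝕜 v x • v := by
    rw [hy, inner_left_stretch hu huv, stretch_apply]
    push_cast
    module
  have hiu : ‖inner 𝕜 u y‖ ≤ ‖y‖ := by simpa [hu] using norm_inner_le_norm (𝕜 := 𝕜) u y
  have hiv : α⁻¹ * ‖inner 𝕜 v x‖ ≤ ‖y‖ := by
    have h := norm_inner_le_norm (𝕜 := 𝕜) v y
    rwa [hy, inner_right_stretch hv huv, hv, one_mul, norm_mul, RCLike.norm_ofReal,
      abs_of_pos (inv_pos.2 hα)] at h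
  rw [e]
  refine (norm_sub_le _ _).trans ?_
  have b1 := norm_sub_le y (inner 𝕜 u y • u)
  rw [norm_smul, hu, mul_one] at b1
  have b2 : ‖((α⁻¹ - 1 : ℝ) : 𝕜) • inner 𝕜 v x • v‖ ≤ α⁻¹ * ‖inner 𝕜 v x‖ := by
    rw [norm_smul, norm_smul, hv, mul_one, RCLike.norm_ofReal, abs_of_nonneg (by linarith)]
    gcongr; linarith
  linarith

end Stretch

/-! ### The distorted basis of one Euclidean block. -/

section StretchBlock

variable (𝕜 : Type) [RCLike 𝕜] (h : ℕ)

/-- The normalized constant vector of a block with `2h = Q²` elements. -/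
noncomputable def constVec (Q : ℝ) : EuclideanSpace 𝕜 (Fin h × Bool) :=
  WithLp.toLp 2 fun _ => ((Q⁻¹ : ℝ) : 𝕜)

/-- The normalized vector of a block with `2h = Q²` elements that has one sign on each half. -/
noncomputable def signVec (Q : ℝ) : EuclideanSpace 𝕜 (Fin h × Bool) :=
  WithLp.toLp 2 fun j => if j.2 then -((Q⁻¹ : ℝ) : 𝕜) else ((Q⁻¹ : ℝ) : 𝕜)

variable {h} {Q : ℝ}

theorem norm_constVec (hQ : 0 < Q) (hh : Q ^ 2 = 2 * h) : ‖constVec 𝕜 h Q‖ = 1 := by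
  rw [EuclideanSpace.norm_eq, Real.sqrt_eq_one]
  simp only [constVec, RCLike.norm_ofReal, sq_abs, Finset.sum_const, Finset.card_univ,
    Fintype.card_prod, Fintype.card_fin, Fintype.card_bool, nsmul_eq_mul]
  push_cast
  rw [mul_comm (h : ℝ), ← hh]
  field_simp

theorem norm_signVec (hQ : 0 < Q) (hh : Q ^ 2 = 2 * h) : ‖signVec 𝕜 h Q‖ = 1 := by
  rw [← norm_constVec 𝕜 hQ hh, EuclideanSpace.norm_eq, EuclideanSpace.norm_eq]
  congr 1
  refine Finset.sum_congr rfl fun j _ => ?_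
  simp only [signVec, constVec]
  split_ifs <;> simp

theorem inner_constVec_signVec : inner 𝕜 (constVec 𝕜 h Q) (signVec 𝕜 h Q) = 0 := by
  rw [PiLp.inner_apply, Fintype.sum_prod_type]
  simp [constVec, signVec]

variable (hQ : 0 < Q) (hh : Q ^ 2 = 2 * h) {α : ℝ} (hα : 0 < α)

/-- The image of the unit vector basis under `stretch`. -/
noncomputable def stretchBasis :
    Module.Basis (Fin h × Bool) 𝕜 (EuclideanSpace 𝕜 (Fin h × Bool)) :=
  (PiLp.basisFun 2 𝕜 (Fin h × Bool)).map
    (stretchEquiv (norm_constVec 𝕜 hQ hh) (norm_signVec 𝕜 hQ hh)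
      (inner_constVec_signVec 𝕜) hα.ne')

theorem stretchBasis_apply (j : Fin h × Bool) : stretchBasis 𝕜 hQ hh hα j
    = stretch (𝕜 := 𝕜) (constVec 𝕜 h Q) (signVec 𝕜 h Q) α (EuclideanSpace.single j 1) := by
  rw [stretchBasis, Module.Basis.map_apply, PiLp.basisFun_apply]
  rfl

theorem stretchBasis_repr (y : EuclideanSpace 𝕜 (Fin h × Bool)) (j : Fin h × Bool) :
    (stretchBasis 𝕜 hQ hh hα).repr y j
      = stretch (𝕜 := 𝕜) (constVec 𝕜 h Q) (signVec 𝕜 h Q) α⁻¹ y j := rfl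

theorem sum_smul_stretchBasis (c : Fin h × Bool → 𝕜) : ∑ j, c j • stretchBasis 𝕜 hQ hh hα j
    = stretch (𝕜 := 𝕜) (constVec 𝕜 h Q) (signVec 𝕜 h Q) α (WithLp.toLp 2 c) := by
  simp only [stretchBasis_apply]
  have : (WithLp.toLp 2 c : EuclideanSpace 𝕜 (Fin h × Bool))
      = ∑ j, c j • EuclideanSpace.single j (1 : 𝕜) := by
    ext i
    simp [Pi.single_apply]
  rw [this, map_sum]
  simp only [map_smul]

/-- The mean of the coordinates of a vector of the block. -/
noncomputable def blockMean (Q α : ℝ) (y : EuclideanSpace 𝕜 (Fin h × Bool)) : 𝕜 :=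
  inner 𝕜 (constVec 𝕜 h Q) (stretch (𝕜 := 𝕜) (constVec 𝕜 h Q) (signVec 𝕜 h Q) α⁻¹ y)
    * ((Q⁻¹ : ℝ) : 𝕜)

variable (hα1 : α ≤ 1)

theorem norm_signVec_apply (hQ : 0 < Q) (j : Fin h × Bool) : ‖signVec 𝕜 h Q j‖ = Q⁻¹ := by
  simp only [signVec]
  split_ifs <;> simp [abs_of_pos hQ]

theorem norm_constVec_apply (hQ : 0 < Q) (j : Fin h × Bool) : ‖constVec 𝕜 h Q j‖ = Q⁻¹ := by
  simp [constVec, abs_of_pos hQ]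

include hα1

theorem norm_stretchBasis_sub_le (j : Fin h × Bool) :
    ‖stretchBasis 𝕜 hQ hh hα j - EuclideanSpace.single j 1‖ ≤ Q⁻¹ + α⁻¹ * Q⁻¹ := by
  rw [stretchBasis_apply]
  refine (norm_stretch_sub_le (norm_constVec 𝕜 hQ hh) (norm_signVec 𝕜 hQ hh) hα hα1 _).trans ?_
  rw [EuclideanSpace.inner_single_right, EuclideanSpace.inner_single_right, one_mul, one_mul,
    RCLike.norm_conj, RCLike.norm_conj, norm_signVec_apply 𝕜 hQ, norm_constVec_apply 𝕜 hQ]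

/-- The condition α ≥ 1/Q keeps vectors and functionals bounded: the entries of u and v have modulus
1/Q, so a factor 1/α is harmless. -/
theorem inv_add_inv_mul_inv_le (hα : 0 < α) (hαQ : Q⁻¹ ≤ α) :
    Q⁻¹ + α⁻¹ * Q⁻¹ ≤ 2 := by
  have h1 : Q⁻¹ ≤ 1 := hαQ.trans hα1
  have h2 : α⁻¹ * Q⁻¹ ≤ 1 := by
    rw [← inv_mul_cancel₀ hα.ne']; gcongr
  linarith

theorem norm_stretchBasis_le (hαQ : Q⁻¹ ≤ α) (j : Fin h × Bool) :
    ‖stretchBasis 𝕜 hQ hh hα j‖ ≤ 3 := by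
  have h1 := norm_stretchBasis_sub_le 𝕜 hQ hh hα hα1 j
  have h2 := inv_add_inv_mul_inv_le hα1 hα hαQ
  have h3 := norm_le_norm_add_norm_sub (EuclideanSpace.single j (1 : 𝕜))
    (stretchBasis 𝕜 hQ hh hα j)
  rw [norm_sub_rev, PiLp.norm_single, norm_one] at h3
  linarith

theorem norm_stretchBasis_repr_le (hαQ : Q⁻¹ ≤ α) (j : Fin h × Bool)
    (y : EuclideanSpace 𝕜 (Fin h × Bool)) :
    ‖(stretchBasis 𝕜 hQ hh hα).repr y j‖ ≤ 3 * ‖y‖ := by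
  have h1 := norm_stretch_inv_sub_le (norm_constVec 𝕜 hQ hh) (norm_signVec 𝕜 hQ hh) hα hα1 y
    (ψ := (EuclideanSpace.proj j : EuclideanSpace 𝕜 (Fin h × Bool) →L[𝕜] 𝕜).toLinearMap)
    (norm_constVec_apply 𝕜 hQ j).le (norm_signVec_apply 𝕜 hQ j).le
  have h2 := inv_add_inv_mul_inv_le hα1 hα hαQ
  have h3 : ‖y j‖ ≤ ‖y‖ := PiLp.norm_apply_le y j
  have h4 : (α⁻¹ * Q⁻¹ + Q⁻¹) * ‖y‖ ≤ 2 * ‖y‖ := by gcongr; linarith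
  rw [stretchBasis_repr]
  refine h1.trans ?_
  change ‖y j‖ + _ ≤ _
  linarith

/-- A Chebyshev estimate: removing the mean is removing the component along the constant vector, so
the deviations have ℓ₂ norm at most 3‖y‖, and |P|/4 ≤ 9‖y‖². -/
theorem card_le_of_half_le_norm_sub_blockMean (y : EuclideanSpace 𝕜 (Fin h × Bool))
    (P : Finset (Fin h × Bool))
    (hP : ∀ j ∈ P, 1 / 2 ≤ ‖(stretchBasis 𝕜 hQ hh hα).repr y j - blockMean 𝕜 Q α y‖) :
    (P.card : ℝ) ≤ 36 * ‖y‖ ^ 2 := by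
  set a := stretch (𝕜 := 𝕜) (constVec 𝕜 h Q) (signVec 𝕜 h Q) α⁻¹ y with ha
  have hy : stretch (𝕜 := 𝕜) (constVec 𝕜 h Q) (signVec 𝕜 h Q) α a = y := by
    have := stretch_inv_stretch (norm_constVec 𝕜 hQ hh) (norm_signVec 𝕜 hQ hh)
      (inner_constVec_signVec 𝕜) (inv_ne_zero hα.ne') y
    rwa [inv_inv] at this
  have h1 := norm_sub_inner_smul_le_norm_stretch (norm_constVec 𝕜 hQ hh)
    (norm_signVec 𝕜 hQ hh) (inner_constVec_signVec 𝕜) hα hα1 a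
  rw [hy] at h1
  have h2 : ‖a - inner 𝕜 (constVec 𝕜 h Q) a • constVec 𝕜 h Q‖ ^ 2 ≤ 9 * ‖y‖ ^ 2 := by
    calc _ ≤ (3 * ‖y‖) ^ 2 := by gcongr
      _ = _ := by ring
  rw [EuclideanSpace.norm_sq_eq] at h2
  have h3 : ∑ _j ∈ P, ((1 : ℝ) / 2) ^ 2 ≤ 9 * ‖y‖ ^ 2 := by
    refine le_trans ?_ h2
    refine le_trans (Finset.sum_le_sum fun j hj => ?_)
      (Finset.sum_le_sum_of_subset_of_nonneg (Finset.subset_univ P) fun _ _ _ => sq_nonneg _)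
    have := hP j hj
    rw [stretchBasis_repr, ← ha, blockMean, ← ha] at this
    gcongr
    exact this
  rw [Finset.sum_const, nsmul_eq_mul] at h3
  linarith

omit hα1 in
include hQ hh hα in
theorem norm_blockMean_le (y : EuclideanSpace 𝕜 (Fin h × Bool)) :
    α * Q * ‖blockMean 𝕜 Q α y‖ ≤ ‖y‖ := by
  have h1 := norm_inner_left_le_norm_stretch (norm_constVec 𝕜 hQ hh)
    (inner_constVec_signVec 𝕜) hα
    (stretch (𝕜 := 𝕜) (constVec 𝕜 h Q) (signVec 𝕜 h Q) α⁻¹ y)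
  have hy := stretch_inv_stretch (norm_constVec 𝕜 hQ hh) (norm_signVec 𝕜 hQ hh)
      (inner_constVec_signVec 𝕜) (inv_ne_zero hα.ne') y
  rw [inv_inv] at hy
  rw [hy] at h1
  refine le_trans (le_of_eq ?_) h1
  rw [blockMean, norm_mul, RCLike.norm_ofReal, abs_of_pos (inv_pos.2 hQ)]
  field_simp

end StretchBlock

/-! ### Exponent 2 is necessary for Markushevich bases. -/

section StretchSystem

open FundamentalMinimalSystem

/-- The sequence `2 ^ (k!)`, whose squares are the lengths of the blocks. -/
noncomputable def blockScale (k : ℕ) : ℝ := 2 ^ k.factorial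

/-- Half the length of the block `k`. -/
def blockHalf (k : ℕ) : ℕ := 2 ^ (2 * (k + 1).factorial - 1)

theorem blockScale_pos (k : ℕ) : 0 < blockScale k := by unfold blockScale; positivity

theorem two_le_blockScale (k : ℕ) : 2 ≤ blockScale k := by
  have := Nat.one_le_iff_ne_zero.2 k.factorial_ne_zero
  calc (2 : ℝ) = 2 ^ 1 := (pow_one _).symm
    _ ≤ _ := pow_le_pow_right₀ (by norm_num) this

theorem blockScale_mono : Monotone blockScale := fun _ _ h =>
  pow_le_pow_right₀ (by norm_num) (Nat.factorial_le h)

theorem blockScale_succ (k : ℕ) : blockScale (k + 1) = blockScale k ^ (k + 1) := by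
  rw [blockScale, blockScale, ← pow_mul, Nat.factorial_succ, mul_comm]

theorem blockScale_sq (k : ℕ) : blockScale (k + 1) ^ 2 = 2 * blockHalf k := by
  have h : 2 * (k + 1).factorial = (2 * (k + 1).factorial - 1) + 1 := by
    have := (k + 1).factorial_pos
    omega
  rw [blockScale, blockHalf, ← pow_mul, mul_comm, h]
  push_cast
  rw [pow_succ]
  ring

theorem blockHalf_pos (k : ℕ) : 0 < blockHalf k := by unfold blockHalf; positivity

/-- The factorial growth makes all blocks before i together no longer than Q_{i+1}, so they can be
estimated by the triangle inequality. -/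
theorem sum_blockScale_sq_le (i : ℕ) :
    ∑ k ∈ Finset.range i, blockScale (k + 1) ^ 2 ≤ blockScale (i + 1) := by
  rcases i with _ | i
  · simpa using (blockScale_pos 1).le
  have h1 : ∀ k ∈ Finset.range (i + 1), blockScale (k + 1) ^ 2 ≤ blockScale (i + 1) ^ 2 := by
    intro k hk
    have := blockScale_mono (show k + 1 ≤ i + 1 by simpa using hk)
    have := blockScale_pos (k + 1)
    gcongr
  refine (Finset.sum_le_sum h1).trans ?_
  rw [Finset.sum_const, Finset.card_range, nsmul_eq_mul, blockScale_succ (i + 1)]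
  have h2 : ((i + 1 : ℕ) : ℝ) ≤ blockScale (i + 1) ^ i := by
    calc ((i + 1 : ℕ) : ℝ) ≤ ((2 ^ i : ℕ) : ℝ) := by exact_mod_cast Nat.lt_two_pow_self
      _ = (2 : ℝ) ^ i := by push_cast; rfl
      _ ≤ _ := by gcongr; exact two_le_blockScale _
  calc _ ≤ blockScale (i + 1) ^ i * blockScale (i + 1) ^ 2 := by gcongr
    _ = _ := by rw [← pow_add]

variable (𝕜 : Type) [RCLike 𝕜]

/-- The blocks, Euclidean spaces of dimension `(blockScale (k + 1)) ^ 2`. -/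
abbrev StretchBlock (k : ULift.{u} ℕ) : Type :=
  EuclideanSpace 𝕜 (Fin (blockHalf k.down) × Bool)

/-- The factor by which the mean is shrunk in the block `k`. -/
noncomputable def blockFactor (k : ℕ) : ℝ := blockScale k / blockScale (k + 1)

theorem blockFactor_pos (k : ℕ) : 0 < blockFactor k :=
  div_pos (blockScale_pos k) (blockScale_pos _)

theorem blockFactor_le_one (k : ℕ) : blockFactor k ≤ 1 :=
  (div_le_one (blockScale_pos _)).2 (blockScale_mono k.le_succ)

theorem inv_blockScale_le_blockFactor (k : ℕ) : (blockScale (k + 1))⁻¹ ≤ blockFactor k := by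
  rw [blockFactor, div_eq_mul_inv]
  exact le_mul_of_one_le_left (inv_nonneg.2 (blockScale_pos _).le)
    (by linarith [two_le_blockScale k])

/-- The bases of the blocks. -/
noncomputable def stretchBlockBasis (k : ULift.{u} ℕ) :
    Module.Basis (Fin (blockHalf k.down) × Bool) 𝕜 (StretchBlock 𝕜 k) :=
  stretchBasis 𝕜 (blockScale_pos (k.down + 1)) (blockScale_sq k.down) (blockFactor_pos k.down)

variable (e : ℕ ≃ Σ k : ULift.{u} ℕ, Fin (blockHalf k.down) × Bool)

theorem norm_stretchBlockBasis_le (k : ULift.{u} ℕ) (j : Fin (blockHalf k.down) × Bool) :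
    ‖stretchBlockBasis 𝕜 k j‖ ≤ 3 :=
  norm_stretchBasis_le 𝕜 _ _ _ (blockFactor_le_one k.down) (inv_blockScale_le_blockFactor k.down) j

theorem norm_stretchBlockBasis_repr_le (k : ULift.{u} ℕ) (j : Fin (blockHalf k.down) × Bool)
    (y : StretchBlock 𝕜 k) : ‖(stretchBlockBasis 𝕜 k).repr y j‖ ≤ 3 * ‖y‖ :=
  norm_stretchBasis_repr_le 𝕜 _ _ _ (blockFactor_le_one k.down)
    (inv_blockScale_le_blockFactor k.down) j y

/-- A Markushevich basis of a Hilbert space. -/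
noncomputable def stretchSystem : FundamentalMinimalSystem 𝕜 (lp (StretchBlock.{u} 𝕜) 2) :=
  blockSystem (stretchBlockBasis 𝕜) e (norm_stretchBlockBasis_le 𝕜)
    (norm_stretchBlockBasis_repr_le 𝕜)

theorem stretchSystem_isMarkushevich : (stretchSystem 𝕜 e).IsMarkushevich :=
  blockSystem_isMarkushevich _ _ _ _

theorem stretchSystem_repr (f : lp (StretchBlock.{u} 𝕜) 2) (k : ULift.{u} ℕ)
    (j : Fin (blockHalf k.down) × Bool) :
    (stretchBlockBasis 𝕜 k).repr (f k) j = (stretchSystem 𝕜 e).dual (e.symm ⟨k, j⟩) f := by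
  rw [stretchSystem, blockSystem_dual, e.apply_symm_apply]

theorem stretchSystem_vec (n : ℕ) : (stretchSystem 𝕜 e).vec n
    = lp.single 2 (e n).1 (stretchBlockBasis 𝕜 (e n).1 (e n).2) := by
  rw [stretchSystem, blockSystem_vec]

theorem norm_stretchSystem_vec_le (n : ℕ) : ‖(stretchSystem 𝕜 e).vec n‖ ≤ 3 := by
  rw [stretchSystem_vec, lp.norm_single (by simp)]
  exact norm_stretchBlockBasis_le 𝕜 _ _

theorem norm_stretchSystem_dual_le (n : ℕ) (f : lp (StretchBlock.{u} 𝕜) 2) :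
    ‖(stretchSystem 𝕜 e).dual n f‖ ≤ 3 * ‖f‖ := by
  rw [stretchSystem, blockSystem_dual]
  refine (norm_stretchBlockBasis_repr_le 𝕜 _ _ _).trans ?_
  gcongr
  exact lp.norm_apply_le_norm two_ne_zero f _

theorem norm_sum_stretchSystem_le (ε : ℕ → 𝕜) (A : Finset ℕ) (hε : IsSignOn ε A) :
    ‖(stretchSystem 𝕜 e).signedSum ε A‖ ≤ 3 * A.card := by
  refine (norm_sum_le _ _).trans ?_
  calc _ ≤ ∑ _n ∈ A, (3 : ℝ) := Finset.sum_le_sum fun n hn => by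
        rw [norm_smul, hε n hn, one_mul]; exact norm_stretchSystem_vec_le 𝕜 e n
    _ = _ := by simp [mul_comm]

/-- The orthonormal basis that `stretchSystem` is built from. -/
noncomputable def unitVec (n : ℕ) : lp (StretchBlock.{u} 𝕜) 2 :=
  lp.single 2 (e n).1 (EuclideanSpace.single (e n).2 (1 : 𝕜))

theorem orthonormal_unitVec : Orthonormal 𝕜 (unitVec 𝕜 e) := by
  constructor
  · intro n
    rw [unitVec, lp.norm_single (by simp), PiLp.norm_single, norm_one]
  · intro m n hmn
    rw [unitVec, lp.inner_single_left, unitVec]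
    by_cases h : (e m).1 = (e n).1
    · rcases hm : e m with ⟨k, x⟩
      rcases hn : e n with ⟨l, y⟩
      rw [hm, hn] at h
      obtain rfl : k = l := h
      have hxy : x ≠ y := fun hxy => hmn (e.injective (by rw [hm, hn, hxy]))
      rw [lp.single_apply_self, EuclideanSpace.inner_single_left]
      simp [hxy]
    · rw [lp.single_apply_ne 2 _ _ h, inner_zero_right]

theorem norm_sum_unitVec (ε : ℕ → 𝕜) (A : Finset ℕ) (hε : IsSignOn ε A) :
    ‖∑ n ∈ A, ε n • unitVec 𝕜 e n‖ = √A.card := by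
  rw [eq_comm, Real.sqrt_eq_iff_mul_self_eq (by positivity) (norm_nonneg _)]
  have h := (orthonormal_unitVec 𝕜 e).inner_sum ε ε A
  rw [inner_self_eq_norm_sq_to_K] at h
  have h2 : ∑ n ∈ A, (starRingEnd 𝕜) (ε n) * ε n = (A.card : 𝕜) := by
    rw [Finset.sum_congr rfl fun n hn => by rw [RCLike.conj_mul, hε n hn]]
    simp
  rw [h2] at h
  rw [← sq]
  exact_mod_cast h.symm

/-- In a block k > i each vector is within 1/Q_{k+1} + 1/Q_k ≤ 2/Q_{i+1} of an orthonormal one, so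
at most Q_{i+1}² of them behave like an orthonormal family. -/
theorem norm_sum_stretchSystem_le_of_lt (ε : ℕ → 𝕜) (A : Finset ℕ) (hε : IsSignOn ε A) {i : ℕ}
    (hA : ∀ n ∈ A, i < (e n).1.down) (hc : (A.card : ℝ) ≤ blockScale (i + 1) ^ 2) :
    ‖(stretchSystem 𝕜 e).signedSum ε A‖ ≤ 3 * blockScale (i + 1) := by
  have hpos := blockScale_pos (i + 1)
  have hdiff : ∀ n ∈ A, ‖(stretchSystem 𝕜 e).vec n - unitVec 𝕜 e n‖
      ≤ 2 * (blockScale (i + 1))⁻¹ := by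
    intro n hn
    rw [stretchSystem_vec, unitVec, ← lp.single_sub, lp.norm_single (by simp)]
    refine (norm_stretchBasis_sub_le 𝕜 _ _ _ (blockFactor_le_one _) _).trans ?_
    have h1 : (blockScale ((e n).1.down + 1))⁻¹ ≤ (blockScale (i + 1))⁻¹ := by
      gcongr; exact blockScale_mono (by have := hA n hn; omega)
    have h2 : (blockFactor (e n).1.down)⁻¹ * (blockScale ((e n).1.down + 1))⁻¹
        ≤ (blockScale (i + 1))⁻¹ := by
      have hp := blockScale_pos ((e n).1.down + 1)
      rw [blockFactor, inv_div, div_mul_eq_mul_div, mul_inv_cancel₀ hp.ne', one_div]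
      gcongr; exact blockScale_mono (hA n hn)
    linarith
  have e1 : (stretchSystem 𝕜 e).signedSum ε A = ∑ n ∈ A, ε n • unitVec 𝕜 e n
      + ∑ n ∈ A, ε n • ((stretchSystem 𝕜 e).vec n - unitVec 𝕜 e n) := by
    rw [← Finset.sum_add_distrib, signedSum]
    exact Finset.sum_congr rfl fun n _ => by rw [smul_sub]; abel
  have h1 : ‖∑ n ∈ A, ε n • unitVec 𝕜 e n‖ ≤ blockScale (i + 1) := by
    rw [norm_sum_unitVec 𝕜 e ε A hε]
    exact Real.sqrt_le_iff.2 ⟨hpos.le, hc⟩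
  have h2 : ‖∑ n ∈ A, ε n • ((stretchSystem 𝕜 e).vec n - unitVec 𝕜 e n)‖
      ≤ 2 * blockScale (i + 1) := by
    refine (norm_sum_le _ _).trans ?_
    calc _ ≤ ∑ _n ∈ A, 2 * (blockScale (i + 1))⁻¹ := Finset.sum_le_sum fun n hn => by
          rw [norm_smul, hε n hn, one_mul]; exact hdiff n hn
      _ = A.card * (2 * (blockScale (i + 1))⁻¹) := by simp
      _ ≤ blockScale (i + 1) ^ 2 * (2 * (blockScale (i + 1))⁻¹) := by gcongr
      _ = _ := by field_simp
  rw [e1]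
  exact (norm_add_le _ _).trans (by linarith)

theorem card_filter_lt_le (A : Finset ℕ) (i : ℕ) :
    ((A.filter fun n => (e n).1.down < i).card : ℝ) ≤ blockScale (i + 1) := by
  refine le_trans ?_ (sum_blockScale_sq_le i)
  rw [Finset.card_eq_sum_card_fiberwise (f := fun n => (e n).1.down) (t := Finset.range i)
    (fun n hn => by simpa using (Finset.mem_filter.1 hn).2)]
  push_cast
  refine Finset.sum_le_sum fun k _ => ?_
  have h1 : ((A.filter fun n => (e n).1.down < i).filter fun n => (e n).1.down = k).card
      ≤ (blockPart e (A.filter fun n => (e n).1.down < i) ⟨k⟩).card := by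
    classical
    rw [card_blockPart]
    refine Finset.card_le_card fun n hn => ?_
    rw [Finset.mem_filter] at hn ⊢
    exact ⟨hn.1, ULift.ext _ _ hn.2⟩
  have h2 := h1.trans (Finset.card_le_univ _)
  rw [Fintype.card_prod, Fintype.card_fin, Fintype.card_bool] at h2
  rw [blockScale_sq]
  have h3 : ((blockHalf k * 2 : ℕ) : ℝ) = 2 * blockHalf k := by push_cast; ring
  rw [← h3]
  exact_mod_cast h2

theorem blockScale_mul_norm_blockMean_le (f : lp (StretchBlock.{u} 𝕜) 2) (k : ULift.{u} ℕ) :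
    blockScale k.down * ‖blockMean 𝕜 (blockScale (k.down + 1)) (blockFactor k.down) (f k)‖
      ≤ ‖f‖ := by
  have h := norm_blockMean_le 𝕜 (blockScale_pos (k.down + 1)) (blockScale_sq k.down)
    (blockFactor_pos k.down) (f k)
  have hp := blockScale_pos (k.down + 1)
  rw [blockFactor, div_mul_cancel₀ _ hp.ne'] at h
  exact h.trans (lp.norm_apply_le_norm two_ne_zero f k)

/-- Either f has a coordinate mean of modulus at least 1/2 in block i, where the zeros on A deviate
from it, or in a later block, where this is expensive, or the coefficients on B deviate from small
means. Each case gives a ≤ 72‖f‖², and the geometric mean with a ≤ Q² is linear in ‖f‖. -/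
theorem card_blockPart_le_of_dual_eq_zero (f : lp (StretchBlock.{u} 𝕜) 2) (A B : Finset ℕ) (i : ℕ)
    (hAB : A.card = B.card) (hB : B.card ≤ blockHalf i) (hne : B.Nonempty)
    (hfB : ∀ n ∈ B, 1 ≤ ‖(stretchSystem 𝕜 e).dual n f‖)
    (hfA : ∀ n ∈ A, (stretchSystem 𝕜 e).dual n f = 0) :
    ((blockPart e A ⟨i⟩).card : ℝ) ≤ 12 * blockScale (i + 1) * ‖f‖ := by
  classical
  have hQ := blockScale_pos (i + 1)
  set Q := blockScale (i + 1) with hQdef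
  obtain ⟨b, hb⟩ := hne
  have hf3 : 1 ≤ 3 * ‖f‖ := (hfB b hb).trans (norm_stretchSystem_dual_le 𝕜 e b f)
  set a : ℝ := ((blockPart e A ⟨i⟩).card : ℝ) with ha
  have ha0 : 0 ≤ a := by positivity
  have haB : a ≤ B.card := by
    rw [ha, card_blockPart, ← hAB]
    exact_mod_cast Finset.card_filter_le _ _
  have hBQ : 2 * (B.card : ℝ) ≤ Q ^ 2 := by
    rw [hQdef, blockScale_sq]
    gcongr
  -- For a ≤ 4Q the bound follows from 1 ≤ 3‖f‖. Otherwise the at most Q positions of B in the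
  -- blocks before i can be absorbed into a.
  rcases le_or_gt a (4 * Q) with hle | hgt
  · nlinarith
  have key : a ≤ 72 * ‖f‖ ^ 2 := by
    set s : ∀ k : ULift.{u} ℕ, 𝕜 := fun k =>
      blockMean 𝕜 (blockScale (k.down + 1)) (blockFactor k.down) (f k) with hs
    have hcard := fun (k : ULift.{u} ℕ) => card_le_of_half_le_norm_sub_blockMean 𝕜
      (blockScale_pos (k.down + 1)) (blockScale_sq k.down)
      (blockFactor_pos k.down) (blockFactor_le_one k.down) (f k)
    by_cases hbig : ∃ k : ULift.{u} ℕ, i < k.down ∧ 1 / 2 ≤ ‖s k‖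
    · obtain ⟨k, hik, hk⟩ := hbig
      have h1 := blockScale_mul_norm_blockMean_le 𝕜 f k
      have h2 : Q ≤ blockScale k.down := blockScale_mono hik
      have h0 := blockScale_pos k.down
      have h3 : Q * (1 / 2) ≤ ‖f‖ := le_trans (by gcongr) h1
      nlinarith
    by_cases hi : 1 / 2 ≤ ‖s ⟨i⟩‖
    · have h1 := hcard ⟨i⟩ (blockPart e A ⟨i⟩) (fun j hj => by
        have : (stretchBlockBasis 𝕜 ⟨i⟩).repr (f ⟨i⟩) j = 0 := by
          rw [stretchSystem_repr 𝕜 e]; exact hfA _ ((mem_blockPart e).1 hj)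
        rw [stretchBlockBasis] at this
        rw [this, zero_sub, norm_neg]
        exact hi)
      have h2 := lp.norm_apply_le_norm two_ne_zero f ⟨i⟩
      have h3 : ‖f ⟨i⟩‖ ^ 2 ≤ ‖f‖ ^ 2 := by gcongr
      nlinarith
    · set B' := B.filter fun n => ¬ (e n).1.down < i with hB'
      have hB'c : (B.card : ℝ) ≤ Q + B'.card := by
        have h1 := Finset.card_filter_add_card_filter_not (s := B) fun n => (e n).1.down < i
        have h2 := card_filter_lt_le e B i
        have h3 : ((B.filter fun n => (e n).1.down < i).card : ℝ) + B'.card = B.card := by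
          exact_mod_cast h1
        linarith
      have h1 : (B'.card : ℝ) ≤ 36 * ‖f‖ ^ 2 := by
        refine card_le_of_blockPart_le e (by norm_num) fun k hk => ?_
        obtain ⟨j₀, hj₀⟩ := hk
        have hki : ¬ k.down < i := by
          have := (Finset.mem_filter.1 ((mem_blockPart e).1 hj₀)).2
          simpa using this
        have hsk : ‖s k‖ < 1 / 2 := by
          rcases Nat.lt_or_ge i k.down with hlt | hge
          · by_contra hcon
            exact hbig ⟨k, hlt, not_lt.1 hcon⟩
          · have : k = ⟨i⟩ := ULift.ext _ _ (by simp; omega)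
            rw [this]; exact not_le.1 hi
        refine hcard k (blockPart e B' k) fun j hj => ?_
        have h1 : 1 ≤ ‖(stretchBlockBasis 𝕜 k).repr (f k) j‖ := by
          rw [stretchSystem_repr 𝕜 e]
          exact hfB _ (Finset.mem_filter.1 ((mem_blockPart e).1 hj)).1
        rw [stretchBlockBasis] at h1
        have h2 := norm_sub_norm_le ((stretchBasis 𝕜 (blockScale_pos (k.down + 1))
          (blockScale_sq k.down) (blockFactor_pos k.down)).repr (f k) j) (s k)
        linarith
      linarith
  have h1 : a ^ 2 ≤ (12 * Q * ‖f‖) ^ 2 := by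
    have h2 : a ≤ Q ^ 2 := by linarith
    calc a ^ 2 = a * a := sq a
      _ ≤ (72 * ‖f‖ ^ 2) * Q ^ 2 := by gcongr
      _ ≤ _ := by nlinarith [sq_nonneg (‖f‖ * Q)]
  exact le_of_sq_le_sq h1 (by positivity)

theorem disjointSqueezeSymmetry_stretchSystem_le (i : ℕ) :
    disjointSqueezeSymmetry 𝕜 _ (stretchSystem 𝕜 e) (blockHalf i)
      ≤ ENNReal.ofReal (54 * blockScale (i + 1)) := by
  classical
  have hQ := blockScale_pos (i + 1)
  refine disjointSqueezeSymmetry_le _ (by positivity) ?_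
  intro f A B ε hne hAB hBm hε hfB hfA
  have hf3 : 1 ≤ 3 * ‖f‖ := by
    obtain ⟨b, hb⟩ := hne
    exact (hfB b hb).trans (norm_stretchSystem_dual_le 𝕜 e b f)
  have hmid := card_blockPart_le_of_dual_eq_zero 𝕜 e f A B i hAB hBm hne hfB hfA
  set Q := blockScale (i + 1) with hQdef
  set A₁ := A.filter fun n => (e n).1.down < i
  set A₂ := A.filter fun n => (e n).1.down = i with hA₂
  set A₃ := A.filter fun n => i < (e n).1.down
  have hsplit : (stretchSystem 𝕜 e).signedSum ε A = (stretchSystem 𝕜 e).signedSum ε A₁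
      + (stretchSystem 𝕜 e).signedSum ε A₂ + (stretchSystem 𝕜 e).signedSum ε A₃ := by
    rw [← signedSum_union, ← signedSum_union]
    · congr 1
      ext n
      simp only [A₁, A₂, A₃, Finset.mem_union, Finset.mem_filter]
      have := lt_trichotomy (e n).1.down i
      tauto
    · rw [Finset.disjoint_left]
      intro n h1 h2
      simp only [A₁, A₂, A₃, Finset.mem_union, Finset.mem_filter] at h1 h2
      omega
    · rw [Finset.disjoint_left]
      intro n h1 h2
      simp only [A₁, A₂, Finset.mem_filter] at h1 h2
      omega
  have hsub : ∀ A' ⊆ A, IsSignOn ε A' := fun A' h n hn => hε n (h hn)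
  have n₁ := norm_sum_stretchSystem_le 𝕜 e ε A₁ (hsub _ (Finset.filter_subset _ _))
  have c₁ := card_filter_lt_le e A i
  have n₂ := norm_sum_stretchSystem_le 𝕜 e ε A₂ (hsub _ (Finset.filter_subset _ _))
  have c₂ : (A₂.card : ℝ) = (blockPart e A ⟨i⟩).card := by
    rw [card_blockPart, hA₂]
    congr 2
    ext n
    simp [ULift.ext_iff]
  have n₃ := norm_sum_stretchSystem_le_of_lt 𝕜 e ε A₃ (hsub _ (Finset.filter_subset _ _)) (i := i)
    (fun n hn => (Finset.mem_filter.1 hn).2) (by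
      rw [blockScale_sq]
      have : A₃.card ≤ blockHalf i := (Finset.card_filter_le _ _).trans (by omega)
      have : (A₃.card : ℝ) ≤ blockHalf i := by exact_mod_cast this
      linarith [Nat.cast_nonneg (α := ℝ) (blockHalf i)])
  rw [hsplit]
  refine (norm_add_le _ _).trans ((add_le_add_left (norm_add_le _ _) _).trans ?_)
  -- The three parts contribute 3Q, 36Q‖f‖ and 3Q; 1 ≤ 3‖f‖ turns the sum into 54Q‖f‖.
  nlinarith

open Classical in
theorem signedSum_stretchSystem_block (ε : ℕ → 𝕜) (k : ULift.{u} ℕ) :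
    (stretchSystem 𝕜 e).signedSum ε (Finset.univ.image fun j => e.symm ⟨k, j⟩)
      = lp.single 2 k (stretch (𝕜 := 𝕜)
        (constVec 𝕜 (blockHalf k.down) (blockScale (k.down + 1)))
        (signVec 𝕜 (blockHalf k.down) (blockScale (k.down + 1))) (blockFactor k.down)
        (WithLp.toLp 2 fun j => ε (e.symm ⟨k, j⟩))) := by
  rw [signedSum, Finset.sum_image (fun _ _ _ _ h => by simpa using h),
    ← sum_smul_stretchBasis 𝕜 (blockScale_pos (k.down + 1)) (blockScale_sq k.down)
      (blockFactor_pos k.down)]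
  refine Eq.trans ?_ (map_sum (lp.lsingle (𝕜 := 𝕜) (E := StretchBlock.{u} 𝕜) 2 k) _ _).symm
  refine Finset.sum_congr rfl fun j _ => ?_
  rw [stretchSystem_vec, e.apply_symm_apply]
  exact (map_smul (lp.lsingle (𝕜 := 𝕜) (E := StretchBlock.{u} 𝕜) 2 k) _ _).symm

theorem norm_signedSum_one_block (k : ULift.{u} ℕ) :
    ‖(stretchSystem 𝕜 e).signedSum (fun _ => 1) (Finset.univ.image fun j => e.symm ⟨k, j⟩)‖
      = blockScale k.down := by
  classical
  have hp := blockScale_pos (k.down + 1)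
  rw [signedSum_stretchSystem_block, lp.norm_single (by simp)]
  have e1 : (WithLp.toLp 2 fun _ => 1 : StretchBlock 𝕜 k)
      = ((blockScale (k.down + 1) : ℝ) : 𝕜)
        • constVec 𝕜 (blockHalf k.down) (blockScale (k.down + 1)) := by
    ext j
    simp only [constVec, PiLp.smul_apply, smul_eq_mul]
    rw [← RCLike.ofReal_mul, mul_inv_cancel₀ hp.ne', RCLike.ofReal_one]
  have hu := norm_constVec 𝕜 hp (blockScale_sq k.down)
  rw [e1, map_smul, stretch_apply, inner_eq_zero_symm.1 (inner_constVec_signVec 𝕜),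
    inner_self_eq_norm_sq_to_K, hu]
  have e2 : ∀ w : StretchBlock 𝕜 k, w + ((blockFactor k.down : 𝕜) - 1) • ((1 : ℝ) : 𝕜) ^ 2 • w
      + (((blockFactor k.down)⁻¹ : ℝ) - 1 : 𝕜) • (0 : 𝕜)
        • signVec 𝕜 (blockHalf k.down) (blockScale (k.down + 1))
      = (blockFactor k.down : 𝕜) • w := by
    intro w
    simp [sub_smul]
  rw [e2, norm_smul, norm_smul, hu, RCLike.norm_ofReal, RCLike.norm_ofReal, abs_of_pos hp,
    abs_of_pos (blockFactor_pos _), blockFactor]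
  field_simp

theorem norm_signedSum_sign_block (k : ULift.{u} ℕ) :
    ‖(stretchSystem 𝕜 e).signedSum (fun n => if (e n).2.2 then -1 else 1)
      (Finset.univ.image fun j => e.symm ⟨k, j⟩)‖
      = blockScale (k.down + 1) ^ 2 / blockScale k.down := by
  classical
  have hp := blockScale_pos (k.down + 1)
  have hp' := blockScale_pos k.down
  rw [signedSum_stretchSystem_block, lp.norm_single (by simp)]
  have e1 : (WithLp.toLp 2 fun j => if (e (e.symm ⟨k, j⟩)).2.2 then -1 else 1 : StretchBlock 𝕜 k)
      = ((blockScale (k.down + 1) : ℝ) : 𝕜)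
        • signVec 𝕜 (blockHalf k.down) (blockScale (k.down + 1)) := by
    ext j
    have hj : (e (e.symm ⟨k, j⟩)).2.2 = j.2 := by rw [e.apply_symm_apply]
    have hmul : ((blockScale (k.down + 1) : ℝ) : 𝕜) *
        (((blockScale (k.down + 1))⁻¹ : ℝ) : 𝕜) = 1 := by
      rw [← RCLike.ofReal_mul, mul_inv_cancel₀ hp.ne', RCLike.ofReal_one]
    simp only [hj, signVec, PiLp.smul_apply, smul_eq_mul]
    split_ifs
    · rw [mul_neg, hmul]
    · rw [hmul]
  have hu := norm_signVec 𝕜 hp (blockScale_sq k.down)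
  rw [e1, map_smul, stretch_apply, inner_constVec_signVec 𝕜,
    inner_self_eq_norm_sq_to_K, hu]
  have e2 : ∀ w : StretchBlock 𝕜 k, w + ((blockFactor k.down : 𝕜) - 1) • (0 : 𝕜)
        • constVec 𝕜 (blockHalf k.down) (blockScale (k.down + 1))
      + (((blockFactor k.down)⁻¹ : ℝ) - 1 : 𝕜) • ((1 : ℝ) : 𝕜) ^ 2 • w
      = (((blockFactor k.down)⁻¹ : ℝ) : 𝕜) • w := by
    intro w
    simp [sub_smul]
  rw [e2, norm_smul, norm_smul, hu, RCLike.norm_ofReal, RCLike.norm_ofReal, abs_of_pos hp,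
    abs_of_pos (inv_pos.2 (blockFactor_pos _)), blockFactor]
  field_simp

theorem le_largestCoeffSymmetry_stretchSystem (i : ℕ) :
    ENNReal.ofReal ((blockScale (i + 1) / blockScale i) ^ 2) ≤
      largestCoeffSymmetry 𝕜 _ (stretchSystem 𝕜 e) (blockHalf i) := by
  classical
  have hp := blockScale_pos (i + 1)
  have hp' := blockScale_pos i
  set S := stretchSystem 𝕜 e with hS
  set g : Fin (blockHalf i) × Bool → ℕ := fun j => e.symm ⟨⟨i⟩, j⟩ with hg
  have hinj : Function.Injective g := fun j j' h => by simpa [hg] using h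
  -- The same half block serves as A and as B, with signs -1 and 1; f is the plain sum over the
  -- other half. The two vectors compared are Q_{i+1} times the images of the sign vector and of the
  -- constant vector.
  set B : Finset ℕ := (Finset.univ.filter fun j : Fin (blockHalf i) × Bool => j.2 = true).image g
    with hB
  set B' : Finset ℕ := (Finset.univ.filter fun j : Fin (blockHalf i) × Bool => ¬ j.2 = true).image g
    with hB'
  have hdisj : Disjoint B B' :=
    (Finset.disjoint_image hinj).2 (Finset.disjoint_filter_filter_not _ _ _)
  have hunion : B ∪ B' = Finset.univ.image g := by
    rw [hB, hB', ← Finset.image_union, Finset.filter_union_filter_not_eq]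
  have hcard : B.card = blockHalf i := by
    rw [hB, Finset.card_image_of_injective _ hinj]
    have : (Finset.univ.filter fun j : Fin (blockHalf i) × Bool => j.2 = true)
        = Finset.univ ×ˢ {true} := by ext ⟨a, b⟩; simp
    rw [this]; simp
  set ε : ℕ → 𝕜 := fun n => if (e n).2.2 then -1 else 1 with hε
  set f : (lp (StretchBlock.{u} 𝕜) 2) := S.signedSum (fun _ => 1) B' with hf
  have hf' : f = S.signedSum ε B' := by
    refine Finset.sum_congr rfl fun n hn => ?_
    obtain ⟨j, hj, rfl⟩ := Finset.mem_image.1 hn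
    have : (e (g j)).2.2 = false := by
      rw [hg, e.apply_symm_apply]; simpa using (Finset.mem_filter.1 hj).2
    simp only [hε, this]
    simp
  have hA1 : S.signedSum ε B + f = S.signedSum ε (Finset.univ.image g) := by
    rw [hf', ← signedSum_union _ hdisj, hunion]
  have hB1 : S.signedSum (fun _ => 1) B + f = S.signedSum (fun _ => 1) (Finset.univ.image g) := by
    rw [hf, ← signedSum_union _ hdisj, hunion]
  have hn1 := norm_signedSum_one_block 𝕜 e ⟨i⟩
  have hn2 := norm_signedSum_sign_block 𝕜 e ⟨i⟩
  refine le_largestCoeffSymmetry S f B B ε (fun _ => 1) rfl hcard.le ?_ ?_ ?_ ?_ (by positivity)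
    ?_ ?_
  · intro n _
    simp only [hε]; split_ifs <;> simp
  · intro n _; simp
  · intro n
    rw [hf, dual_signedSum]; split_ifs <;> simp
  · rw [Set.disjoint_left]
    intro n hn hnB
    rw [Finset.union_self] at hnB
    refine hn ?_
    rw [hf, dual_signedSum, if_neg (Finset.disjoint_left.1 hdisj hnB)]
  · rw [hA1, hB1]
    refine le_of_eq ?_
    refine (congrArg _ hn1).trans (Eq.trans ?_ hn2.symm)
    field_simp
  · rw [hB1]
    intro h0
    have h1 : (0 : ℝ) = blockScale i := by
      rw [← hn1]
      refine Eq.trans ?_ (congrArg norm h0).symm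
      exact norm_zero.symm
    linarith

theorem two_le_of_mem_exponentsM {R : ℝ}
    (hR : R ∈ exponentsM 𝕜 (largestCoeffSymmetry.{u} 𝕜) (disjointSqueezeSymmetry.{u} 𝕜)) :
    2 ≤ R := by
  have hne : ∀ k : ULift.{u} ℕ, Nonempty (Fin (blockHalf k.down) × Bool) := fun k =>
    ⟨⟨⟨0, blockHalf_pos _⟩, true⟩⟩
  obtain ⟨e⟩ := exists_equiv_sigma.{u} (J := fun k => Fin (blockHalf k.down) × Bool)
  have : IsPBanachSpace 𝕜 1 (lp (StretchBlock.{u} 𝕜) 2) := isPBanachSpace_one 𝕜 _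
  obtain ⟨C, hC⟩ := hR 1 _ (stretchSystem 𝕜 e) (stretchSystem_isMarkushevich 𝕜 e)
  by_contra hlt
  rw [not_le] at hlt
  set R' := max R 0 with hR'
  have hR2 : R' < 2 := max_lt hlt two_pos
  have hR0 : 0 ≤ R' := le_max_right _ _
  have key : ∀ i : ℕ, (blockScale (i + 1) / blockScale i) ^ 2
      ≤ C * (54 * blockScale (i + 1)) ^ R' := fun i =>
    le_mul_rpow_of_div_rpow_le (hC (blockHalf i) (blockHalf_pos i))
      (one_le_disjointSqueezeSymmetry 1 _ (blockHalf_pos i))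
      (le_largestCoeffSymmetry_stretchSystem 𝕜 e i)
      (disjointSqueezeSymmetry_stretchSystem_le 𝕜 e i)
  -- Substituting Q_{i+1} = Q_i^{i+1} leaves a power of Q_i whose exponent tends to infinity when R'
  -- < 2.
  have key2 : ∀ i : ℕ, blockScale i ^ (((i : ℝ) + 1) * (2 - R') - 2) ≤ C * 54 ^ R' := by
    intro i
    have hp := blockScale_pos i
    have h := key i
    rw [Real.mul_rpow (by norm_num) (blockScale_pos _).le, blockScale_succ,
      ← Real.rpow_natCast (blockScale i) (i + 1), ← Real.rpow_mul hp.le, ← mul_assoc] at h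
    have e1 : (blockScale i ^ ((i + 1 : ℕ) : ℝ) / blockScale i) ^ 2
        = blockScale i ^ (((i : ℝ) + 1) * (2 - R') - 2)
          * blockScale i ^ (((i + 1 : ℕ) : ℝ) * R') := by
      rw [← Real.rpow_add hp, div_pow, ← Real.rpow_natCast, ← Real.rpow_natCast,
        ← Real.rpow_mul hp.le, ← Real.rpow_sub hp]
      congr 1; push_cast; ring
    rw [e1] at h
    exact le_of_mul_le_mul_right h (Real.rpow_pos_of_pos hp _)
  -- i₁ makes the exponent at least 1, and i₂ makes Q_i ≥ i exceed the constant.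
  obtain ⟨i₁, hi₁⟩ := exists_nat_gt (3 / (2 - R'))
  obtain ⟨i₂, hi₂⟩ := exists_nat_gt ((C : ℝ) * 54 ^ R')
  set i := max i₁ i₂ with hi
  have h1 : 1 ≤ ((i : ℝ) + 1) * (2 - R') - 2 := by
    rw [div_lt_iff₀ (by linarith)] at hi₁
    have : (i₁ : ℝ) ≤ i := by exact_mod_cast le_max_left _ _
    nlinarith
  have h2 : (i : ℝ) ≤ blockScale i := by
    calc (i : ℝ) ≤ ((2 ^ i.factorial : ℕ) : ℝ) := by
          exact_mod_cast (Nat.self_le_factorial i).trans Nat.lt_two_pow_self.le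
      _ = _ := by rw [blockScale]; push_cast; rfl
  have h3 : blockScale i ≤ blockScale i ^ (((i : ℝ) + 1) * (2 - R') - 2) :=
    Real.self_le_rpow_of_one_le (by linarith [two_le_blockScale i]) h1
  have h4 : (i₂ : ℝ) ≤ i := by exact_mod_cast le_max_right _ _
  linarith [key2 i]

end StretchSystem

theorem mainTheorem8 (𝕜 : Type) [RCLike 𝕜] :
    (ratioB 𝕜 (largestCoeffSymmetry.{u} 𝕜) (squeezeSymmetry.{u} 𝕜) = 1 ∧
      ratioM 𝕜 (largestCoeffSymmetry.{u} 𝕜) (squeezeSymmetry.{u} 𝕜) = 1 ∧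
      ratioS 𝕜 (largestCoeffSymmetry.{u} 𝕜) (squeezeSymmetry.{u} 𝕜) = 1) ∧
    (ratioB 𝕜 (largestCoeffSymmetry.{u} 𝕜) (disjointSqueezeSymmetry.{u} 𝕜) = 2 ∧
      ratioM 𝕜 (largestCoeffSymmetry.{u} 𝕜) (disjointSqueezeSymmetry.{u} 𝕜) = 2 ∧
      ratioS 𝕜 (largestCoeffSymmetry.{u} 𝕜) (disjointSqueezeSymmetry.{u} 𝕜) = 1) := by
  have hS1 : ∀ R ∈ exponentsS 𝕜 (largestCoeffSymmetry.{u} 𝕜) (squeezeSymmetry.{u} 𝕜), 1 ≤ R :=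
    fun R hR => one_le_of_mem_exponentsS 𝕜 _ (fun X _ _ _ S m hm => by
      have : IsPBanachSpace 𝕜 1 X := isPBanachSpace_one 𝕜 X
      exact ⟨one_le_squeezeSymmetry 1 S hm, le_rfl⟩) hR
  have hS2 : ∀ R ∈ exponentsS 𝕜 (largestCoeffSymmetry.{u} 𝕜) (disjointSqueezeSymmetry.{u} 𝕜),
      1 ≤ R :=
    fun R hR => one_le_of_mem_exponentsS 𝕜 _ (fun X _ _ _ S m hm => by
      have : IsPBanachSpace 𝕜 1 X := isPBanachSpace_one 𝕜 X
      exact ⟨one_le_disjointSqueezeSymmetry 1 S hm,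
        disjointSqueezeSymmetry_le_squeezeSymmetry S m⟩) hR
  have hBM := fun a b => exponentsB_subset_exponentsM.{u} 𝕜 a b
  have hMS := fun a b => exponentsM_subset_exponentsS.{u} 𝕜 a b
  have h1 := one_mem_exponentsB_squeezeSymmetry.{u} 𝕜
  have h2 := two_mem_exponentsB_disjointSqueezeSymmetry.{u} 𝕜
  refine ⟨⟨?_, ?_, ?_⟩, ?_, ?_, ?_⟩
  · exact EReal.sInf_image_coe_of_isLeast ⟨h1, fun R hR => hS1 R (hMS _ _ (hBM _ _ hR))⟩
  · exact EReal.sInf_image_coe_of_isLeast ⟨hBM _ _ h1, fun R hR => hS1 R (hMS _ _ hR)⟩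
  · exact EReal.sInf_image_coe_of_isLeast ⟨hMS _ _ (hBM _ _ h1), hS1⟩
  · exact EReal.sInf_image_coe_of_isLeast
      ⟨h2, fun R hR => two_le_of_mem_exponentsM 𝕜 (hBM _ _ hR)⟩
  · exact EReal.sInf_image_coe_of_isLeast
      ⟨hBM _ _ h2, fun R hR => two_le_of_mem_exponentsM 𝕜 hR⟩
  · exact EReal.sInf_image_coe_of_isLeast
      ⟨one_mem_exponentsS_disjointSqueezeSymmetry 𝕜, hS2⟩
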